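/- Let $n\ge 3$, let $\Omega\subset\mathbb{R}^n$ be a bounded domain with smooth boundary, and let $M\ge 0$ be an even integer. Let $\mathbb{K}$ be $\mathbb{R}$ or $\mathbb{C}$, and let $C^\infty(\overline\Omega)$ be the space of $\mathbb{K}$-valued functions on $\overline\Omega$ that are restrictions of smooth functions on $\mathbb{R}^n$. For $0\le p\le M$ let $S^p(C^\infty(\overline\Omega))$ be the space of symmetric $p$-tensor fields on $\overline\Omega$ with components in $C^\infty(\overline\Omega)$, with its usual topology (uniform convergence on $\overline\Omega$ of the derivatives of each order), and give $\mathbf{S}^M(C^\infty(\overline\Omega))=\bigoplus_{p=0}^M S^p(C^\infty(\overline\Omega))$ the product topology. For $u,v\in C^\infty(\overline\Omega)$ let $v\,\oplus_{0\le|\alpha|\le M}D^\alpha u$ denote the element of $\mathbf{S}^M(C^\infty(\overline\Omega))$ whose component of order $p$ is $v\,D^pu$, where $D^pu$ is the symmetric $p$-tensor field with components $\partial_{i_1}\cdots\partial_{i_p}u$. Then the linear span over $\mathbb{K}$ $$\mathcal{A}_M=\operatorname{span}\left\{v\,\oplus_{0\le|\alpha|\le M}D^\alpha u \;:\; u,v\in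 C^\infty(\overline\Omega),\ \Delta^{\frac{M+2}{2}}u=\Delta^{\frac{M+2}{2}}v=0\ \text{in}\ \Omega\right\}$$ is dense in $\mathbf{S}^M(C^\infty(\overline\Omega))$. -/

import Mathlib

open scoped ContDiff

noncomputable section

namespace PolyharmonicDensity

/-- Symmetry of iterated derivatives under adjacent transpositions. -/
theorem iteratedFDeriv_swap_apply {E F : Type*} [NormedAddCommGroup E] [NormedSpace ℝ E]
    [NormedAddCommGroup F] [NormedSpace ℝ F] {f : E → F} (hf : ContDiff ℝ ∞ f) :
    ∀ (k : ℕ) (i : Fin k) (x : E) (w : Fin (k + 1) → E),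
      iteratedFDeriv ℝ (k + 1) f x (w ∘ Equiv.swap i.castSucc i.succ) =
        iteratedFDeriv ℝ (k + 1) f x w := by
  intro k
  induction k with
  | zero => exact fun i => i.elim0
  | succ k ih =>
    have hd : ∀ j : ℕ, ContDiff ℝ ∞ (iteratedFDeriv ℝ j f) := fun j =>
      hf.iteratedFDeriv_right (m := ∞) (by exact_mod_cast le_top)
    have h1 : ∀ (x v : E) (t : Fin (k + 1) → E),
        fderiv ℝ (iteratedFDeriv ℝ (k + 1) f) x v t =
          fderiv ℝ (fun y => iteratedFDeriv ℝ (k + 1) f y t) x v := by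
      intro x v t
      have := (((hd (k + 1)).differentiable (by simp)) x).hasFDerivAt
      have h3 := ((ContinuousMultilinearMap.apply ℝ (fun _ : Fin (k + 1) => E) F t).hasFDerivAt
        (x := iteratedFDeriv ℝ (k + 1) f x)).comp x this
      rw [show (fun y => iteratedFDeriv ℝ (k + 1) f y t) =
        (ContinuousMultilinearMap.apply ℝ (fun _ : Fin (k + 1) => E) F t) ∘
          iteratedFDeriv ℝ (k + 1) f from rfl, h3.fderiv]
      rfl
    intro i x w
    induction i using Fin.cases with
    | zero =>
      have h2 : ∀ t : Fin (k + 2) → E, iteratedFDeriv ℝ (k + 2) f x t =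
          fderiv ℝ (fderiv ℝ (iteratedFDeriv ℝ k f)) x (t 0) (t 1) (Fin.tail (Fin.tail t)) := by
        intro t
        rw [iteratedFDeriv_succ_apply_left]
        rw [h1]
        have h3 := ((ContinuousMultilinearMap.apply ℝ (fun _ : Fin k => E) F
          (Fin.tail (Fin.tail t))).hasFDerivAt
          (x := fderiv ℝ (iteratedFDeriv ℝ k f) x (t 1))).comp x
          ((((hd k).fderiv_right (m := ∞) (by simp)).differentiable (by simp) x).hasFDerivAt.clm_apply
            (hasFDerivAt_const (t 1) x))
        rw [show (fun y => iteratedFDeriv ℝ (k + 1) f y (Fin.tail t)) =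
          (ContinuousMultilinearMap.apply ℝ (fun _ : Fin k => E) F (Fin.tail (Fin.tail t))) ∘
            fun y => fderiv ℝ (iteratedFDeriv ℝ k f) y (t 1) from rfl, h3.fderiv]
        simp
      have hs : IsSymmSndFDerivAt ℝ (iteratedFDeriv ℝ k f) x :=
        (hd k).contDiffAt.isSymmSndFDerivAt
          (by simpa using (by exact_mod_cast le_top : ((2 : ℕ∞) : WithTop ℕ∞) ≤ ∞))
      rw [h2, h2]
      have e : Fin.tail (Fin.tail (w ∘ Equiv.swap (Fin.castSucc (0 : Fin (k + 1))) (Fin.succ 0))) =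
          Fin.tail (Fin.tail w) := by
        funext j
        simp only [Fin.tail, Function.comp]
        rw [Equiv.swap_apply_of_ne_of_ne]
        · exact Fin.succ_ne_zero _
        · exact fun h => Fin.succ_ne_zero _ (Fin.succ_injective _ h)
      rw [e, hs.eq]
      simp
    | succ j =>
      rw [iteratedFDeriv_succ_apply_left, iteratedFDeriv_succ_apply_left, h1, h1]
      have e0 : (w ∘ Equiv.swap (Fin.castSucc j.succ) (Fin.succ j.succ)) 0 = w 0 := by
        simp only [Function.comp]
        rw [Equiv.swap_apply_of_ne_of_ne]
        · exact fun h => Fin.succ_ne_zero j (Fin.castSucc_injective _ h.symm)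
        · exact (Fin.succ_ne_zero _).symm
      have e1 : Fin.tail (w ∘ Equiv.swap (Fin.castSucc j.succ) (Fin.succ j.succ)) =
          Fin.tail w ∘ Equiv.swap j.castSucc j.succ := by
        funext l
        simp only [Fin.tail, Function.comp, Equiv.swap_apply_def, Fin.castSucc_succ,
          Fin.succ_inj]
        split_ifs <;> rfl
      rw [e0, e1]
      simp only [ih]

/-- The iterated derivatives of a smooth function are symmetric multilinear maps. -/
theorem iteratedFDeriv_comp_perm_apply {E F : Type*} [NormedAddCommGroup E] [NormedSpace ℝ E]
    [NormedAddCommGroup F] [NormedSpace ℝ F] {f : E → F} (hf : ContDiff ℝ ∞ f) (k : ℕ)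
    (x : E) (σ : Equiv.Perm (Fin k)) (w : Fin k → E) :
    iteratedFDeriv ℝ k f x (w ∘ σ) = iteratedFDeriv ℝ k f x w := by
  cases k with
  | zero => exact congrArg _ (Subsingleton.elim _ _)
  | succ k =>
    have hσ : σ ∈ Submonoid.closure
        (Set.range fun i : Fin k => Equiv.swap i.castSucc i.succ) := by
      rw [Equiv.Perm.mclosure_swap_castSucc_succ]; trivial
    induction hσ using Submonoid.closure_induction generalizing w with
    | mem τ h => obtain ⟨i, rfl⟩ := h; exact iteratedFDeriv_swap_apply hf k i x w
    | one => rfl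
    | mul a b _ _ iha ihb =>
      have : w ∘ (a * b : Equiv.Perm (Fin (k + 1))) = (w ∘ a) ∘ b := rfl
      rw [this, ihb, iha]

/-- `Ω ⊆ ℝⁿ` is a bounded domain (non-empty, open, connected) with smooth boundary: near each
boundary point it is the sublevel set `{ρ < 0}` of a smooth function with non-vanishing
differential at that point. -/
structure IsSmoothBoundedDomain {n : ℕ} (Ω : Set (EuclideanSpace ℝ (Fin n))) : Prop where
  isOpen : IsOpen Ω
  isConnected : IsConnected Ω
  isBounded : Bornology.IsBounded Ω
  smooth_boundary : ∀ x ∈ frontier Ω, ∃ ρ : EuclideanSpace ℝ (Fin n) → ℝ,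
    ∃ U ∈ nhds x, ContDiff ℝ ∞ ρ ∧ fderiv ℝ ρ x ≠ 0 ∧ Ω ∩ U = {y | ρ y < 0} ∩ U

/-- The `𝕜`-vector space of smooth symmetric `p`-tensor fields on `closure Ω`. A `p`-tensor is a
`p`-linear form on `ℝⁿ` with values in `𝕜`; its components are `T (e_{i₁}, …, e_{i_p})`. Smooth on
`closure Ω` means: the restriction to `closure Ω` of a smooth map on `ℝⁿ`. -/
def symTensorFieldSubmodule (𝕜 : Type*) [RCLike 𝕜] {n : ℕ} (Ω : Set (EuclideanSpace ℝ (Fin n)))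
    (p : ℕ) : Submodule 𝕜 (closure Ω → (EuclideanSpace ℝ (Fin n)) [×p]→L[ℝ] 𝕜) where
  carrier := {f |
    (∃ g : EuclideanSpace ℝ (Fin n) → (EuclideanSpace ℝ (Fin n)) [×p]→L[ℝ] 𝕜,
      ContDiff ℝ ∞ g ∧ ∀ x : closure Ω, f x = g x) ∧
    ∀ (x : closure Ω) (σ : Equiv.Perm (Fin p)) (w : Fin p → EuclideanSpace ℝ (Fin n)),
      f x (w ∘ σ) = f x w}
  add_mem' := by
    rintro a b ⟨⟨g, hg, hag⟩, ha⟩ ⟨⟨h, hh, hbh⟩, hb⟩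
    refine ⟨⟨fun x => g x + h x, hg.add hh, fun x => ?_⟩, fun x σ w => ?_⟩
    · simp [hag, hbh]
    · simp [ha, hb]
  zero_mem' := ⟨⟨fun _ => 0, contDiff_const, fun _ => rfl⟩, fun _ _ _ => rfl⟩
  smul_mem' := by
    rintro c a ⟨⟨g, hg, hag⟩, ha⟩
    refine ⟨⟨fun x => c • g x, hg.const_smul c, fun x => ?_⟩, fun x σ w => ?_⟩
    · simp [hag]
    · simp [ha]

/-- `S^p(C^∞(closure Ω))`, the smooth symmetric `p`-tensor fields on `closure Ω`. -/
def SymTensorField (𝕜 : Type*) [RCLike 𝕜] {n : ℕ} (Ω : Set (EuclideanSpace ℝ (Fin n)))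
    (p : ℕ) : Type _ :=
  symTensorFieldSubmodule 𝕜 Ω p

variable {𝕜 : Type*} [RCLike 𝕜] {n : ℕ} {Ω : Set (EuclideanSpace ℝ (Fin n))} {p : ℕ}

instance : AddCommGroup (SymTensorField 𝕜 Ω p) :=
  inferInstanceAs (AddCommGroup (symTensorFieldSubmodule 𝕜 Ω p))

instance : Module 𝕜 (SymTensorField 𝕜 Ω p) :=
  inferInstanceAs (Module 𝕜 (symTensorFieldSubmodule 𝕜 Ω p))

namespace SymTensorField

/-- A smooth extension of the field to `ℝⁿ`. -/
def extension (f : SymTensorField 𝕜 Ω p) :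
    EuclideanSpace ℝ (Fin n) → (EuclideanSpace ℝ (Fin n)) [×p]→L[ℝ] 𝕜 :=
  f.2.1.choose

theorem contDiff_extension (f : SymTensorField 𝕜 Ω p) : ContDiff ℝ ∞ f.extension :=
  f.2.1.choose_spec.1

theorem extension_apply (f : SymTensorField 𝕜 Ω p) (x : closure Ω) : f.extension x = f.1 x :=
  (f.2.1.choose_spec.2 x).symm

/-- The `k`-th derivative of a smooth field, as a map on `closure Ω`. -/
def iteratedDerivOnClosure (k : ℕ) (f : SymTensorField 𝕜 Ω p) (x : closure Ω) :
    (EuclideanSpace ℝ (Fin n)) [×k]→L[ℝ] ((EuclideanSpace ℝ (Fin n)) [×p]→L[ℝ] 𝕜) :=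
  iteratedFDeriv ℝ k f.extension x

/-- For open `Ω`, the derivatives on `closure Ω` do not depend on the choice of the extension. -/
theorem iteratedDerivOnClosure_eq (hΩ : IsOpen Ω) (k : ℕ) (f : SymTensorField 𝕜 Ω p)
    {g : EuclideanSpace ℝ (Fin n) → (EuclideanSpace ℝ (Fin n)) [×p]→L[ℝ] 𝕜}
    (hg : ContDiff ℝ ∞ g) (hfg : ∀ x : closure Ω, f.1 x = g x) (x : closure Ω) :
    f.iteratedDerivOnClosure k x = iteratedFDeriv ℝ k g x := by
  have key : Set.EqOn (iteratedFDeriv ℝ k f.extension) (iteratedFDeriv ℝ k g) Ω := by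
    intro y hy
    refine Filter.EventuallyEq.eq_of_nhds (Filter.EventuallyEq.iteratedFDeriv (𝕜 := ℝ) ?_ k)
    filter_upwards [hΩ.mem_nhds hy] with z hz
    have := f.extension_apply ⟨z, subset_closure hz⟩
    rw [hfg] at this
    exact this
  exact key.closure (f.contDiff_extension.continuous_iteratedFDeriv (by exact_mod_cast le_top))
    (hg.continuous_iteratedFDeriv (by exact_mod_cast le_top)) x.2

/-- The `C^∞(closure Ω)` topology: uniform convergence on `closure Ω` of the derivatives of every
order `k = 0, 1, 2, …`. -/
instance : TopologicalSpace (SymTensorField 𝕜 Ω p) :=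
  ⨅ k : ℕ, TopologicalSpace.induced
    (fun f => UniformFun.ofFun (f.iteratedDerivOnClosure k)) inferInstance

end SymTensorField

variable (𝕜 Ω) in
/-- `⊕_{p=0}^M S^p(C^∞(closure Ω))`, a finite direct sum, with the product topology. -/
abbrev SymTensorFields (M : ℕ) : Type _ :=
  (p : Fin (M + 1)) → SymTensorField 𝕜 Ω p

variable (Ω) in
/-- The element `v ⊕_{0 ≤ |α| ≤ M} D^α u`: its component of order `p` is the field `v D^p u`, where
`D^p u` is the symmetric tensor with components `∂_{i₁} ⋯ ∂_{i_p} u`. -/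
def derivativeProduct (M : ℕ) (u v : EuclideanSpace ℝ (Fin n) → 𝕜) (hu : ContDiff ℝ ∞ u)
    (hv : ContDiff ℝ ∞ v) : SymTensorFields 𝕜 Ω M := fun p =>
  ⟨fun x => v x • iteratedFDeriv ℝ p u x,
    ⟨fun x => v x • iteratedFDeriv ℝ p u x,
      hv.smul (hu.iteratedFDeriv_right (m := ∞) (by exact_mod_cast le_top)), fun _ => rfl⟩,
    fun x σ w => by simp [iteratedFDeriv_comp_perm_apply hu p (x : EuclideanSpace ℝ (Fin n)) σ w]⟩

/-- `Δ^m u = 0` in `Ω`. -/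
def IsPolyharmonicOn (m : ℕ) (u : EuclideanSpace ℝ (Fin n) → 𝕜)
    (Ω : Set (EuclideanSpace ℝ (Fin n))) : Prop :=
  ∀ x ∈ Ω, (Laplacian.laplacian^[m] u) x = 0

variable (𝕜 Ω) in
/-- The span of all `v ⊕_{0 ≤ |α| ≤ M} D^α u`, where `u, v` are smooth on `closure Ω` (given by
smooth extensions to `ℝⁿ`) and satisfy `Δ^{(M+2)/2} u = Δ^{(M+2)/2} v = 0` in `Ω`. -/
def productSpan (M : ℕ) : Submodule 𝕜 (SymTensorFields 𝕜 Ω M) :=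
  Submodule.span 𝕜 {F | ∃ (u v : EuclideanSpace ℝ (Fin n) → 𝕜) (hu : ContDiff ℝ ∞ u)
    (hv : ContDiff ℝ ∞ v), IsPolyharmonicOn ((M + 2) / 2) u Ω ∧
      IsPolyharmonicOn ((M + 2) / 2) v Ω ∧ F = derivativeProduct Ω M u v hu hv}

end PolyharmonicDensity

end

/-!
The density holds because the span contains every field with polynomial components, and these are
dense by the Weierstrass theorem in its `C^∞` form. Put `M = 2 k`.

The algebraic part happens in a plane. Two vectors `ξ`, `θ` of `ℝⁿ` lie in a plane with an
orthonormal frame `f`, and a polynomial in `⟪f 0, x⟫`, `⟪f 1, x⟫` is polyharmonic of order `k + 1`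
if `(∂₀² + ∂₁²)^(k + 1)` kills the polynomial. Let `ψ` be a linear functional that kills all
products `v ⊕ D^α u` of polyharmonic functions. For a fixed `d`, put `v_i = ⟪ξ - θ, x⟫^i / i!` and
`u_j = ⟪θ, x⟫^j / j!`, and consider `h(θ) = ∑_{i + j = d} ψ(v_i ⊕ D^α u_j)`, although these
functions are not polyharmonic. Two descriptions of `h` conflict unless `h = 0`:

* By the binomial theorem, the sum is `∑_p ψ(⟪ξ, x⟫^(d - p) / (d - p)! ⊗ θ^{⊗ p})`, a polynomial in
  `θ` of degree at most `2 k` (`sum_divPow_mul_divPow`, `derivativeProductBilin_divPow`).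
* The bilinear form `(v, u) ↦ ψ(v ⊕ D^α u)` vanishes on `ker Δ^(k + 1) × ker Δ^(k + 1)`, so it is a
  sum of two forms that factor through `Δ^(k + 1)` in one of the variables
  (`exists_bilin_eq_add_of_ker`). As `Δ^(k + 1)` acts on divided powers of `ξ - θ` and of `θ` by the
  factors `|ξ - θ|^(2 k + 2)` and `|θ|^(2 k + 2)`, `h` lies in the ideal generated by these two
  polynomials.

A polynomial of degree at most `2 k` in this ideal is zero (`eq_zero_of_mem_sqDist_pow`). By
induction on `k`: the Laplacian maps the ideal to the one with exponents `2 k`, because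
`|∇ q|² = 4 q` for `q = |θ - a|²`, so `h` is harmonic. On the line of points equidistant from `0`
and `ξ` both generators restrict to the same polynomial of degree `2 k + 2`, which divides the
restriction of `h`; similarly for the normal derivative, with `2 k`. Both restrictions have smaller
degree, so they vanish, and `h = 0` by uniqueness in the Cauchy problem.

Replacing `θ` by `r θ` separates the orders `p`, so all the fields `⟪ξ, x⟫^j θ^{⊗ p}`, placed in a
single component `p`, lie in the span (`single_tensorField_ridge_mem`). Polarization in `ξ` and in
`θ` gives all symmetric polynomial tensor fields (`single_tensorField_prodInner_mem`). Finally, a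
smooth field, cut off outside a ball containing `closure Ω`, is convolved with the normalized powers
of `1 - |y|² / ρ²`: the results are polynomials on `ℝⁿ`, and each of their derivatives converges
uniformly on the ball (`eventually_norm_iteratedFDeriv_landauApprox_sub_le`).
-/

noncomputable section

namespace PolyharmonicDensity

/-! ### Polynomials in two variables -/

section PlanePolynomials
open MvPolynomial

/-- The Laplacian `∂₀² + ∂₁²` on polynomials in two variables. -/
def planeLaplacian (K : Type*) [Field K] :
    MvPolynomial (Fin 2) K →ₗ[K] MvPolynomial (Fin 2) K :=
  (pderiv 0).toLinearMap ∘ₗ (pderiv 0).toLinearMap +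
    (pderiv 1).toLinearMap ∘ₗ (pderiv 1).toLinearMap

variable {K : Type*} [Field K]

theorem planeLaplacian_apply (p : MvPolynomial (Fin 2) K) :
    planeLaplacian K p = pderiv 0 (pderiv 0 p) + pderiv 1 (pderiv 1 p) := rfl

theorem pderiv_one_zero_comm (p : MvPolynomial (Fin 2) K) :
    pderiv 1 (pderiv 0 p) = pderiv 0 (pderiv 1 p) := by
  induction p using MvPolynomial.induction_on with
  | C r => simp
  | add p q hp hq => simp [hp, hq]
  | mul_X p i hp => fin_cases i <;> simp [hp] <;> ring

theorem totalDegree_pderiv_le {σ : Type*} (i : σ) (p : MvPolynomial σ K) :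
    (pderiv i p).totalDegree ≤ p.totalDegree - 1 := by
  classical
  refine Finset.sup_le fun m hm => ?_
  rw [mem_support_iff, coeff_pderiv] at hm
  have h := le_totalDegree (mem_support_iff.2 (left_ne_zero_of_mul hm))
  rw [Finsupp.sum_add_index' (by simp) (by simp)] at h
  simp at h
  omega

/-- The squared distance to the point `(c, 0)`. -/
def sqDist (c : K) : MvPolynomial (Fin 2) K := (X 0 - C c) ^ 2 + X 1 ^ 2

theorem pderiv_zero_sqDist (c : K) : pderiv 0 (sqDist c) = 2 * (X 0 - C c) := by
  simp [sqDist]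

theorem pderiv_one_sqDist (c : K) : pderiv 1 (sqDist c) = 2 * X 1 := by
  simp [sqDist]

theorem exists_pderiv_mul_pow_succ (i : Fin 2) (A q : MvPolynomial (Fin 2) K) (k : ℕ) :
    ∃ B, pderiv i (A * q ^ (k + 1)) = B * q ^ k :=
  ⟨pderiv i A * q + A * ((k + 1) * pderiv i q), by
    rw [pderiv_mul, pderiv_pow, Nat.add_sub_cancel]; push_cast; ring⟩

/-- The Laplacian lowers the order of vanishing along the circle `sqDist c = 0` by one only,
because `|∇ q|² = 4 q` for `q = sqDist c`. -/
theorem exists_planeLaplacian_mul_pow_succ (c : K) (A : MvPolynomial (Fin 2) K) (k : ℕ) :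
    ∃ B, planeLaplacian K (A * sqDist c ^ (k + 1)) = B * sqDist c ^ k := by
  rcases k with _ | k
  · exact ⟨planeLaplacian K (A * sqDist c), by simp⟩
  refine ⟨planeLaplacian K A * sqDist c + 2 * (k + 2) * (pderiv 0 A * pderiv 0 (sqDist c) +
    pderiv 1 A * pderiv 1 (sqDist c)) + A * ((k + 2) * 4 + (k + 2) * (k + 1) * 4), ?_⟩
  have hk (i : Fin 2) (j : ℕ) : pderiv (R := K) i (j : MvPolynomial (Fin 2) K) = 0 := by
    simp
  have hk2 (i : Fin 2) : pderiv (R := K) i 2 = 0 := by simpa using hk i 2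
  simp only [planeLaplacian_apply, pderiv_mul, pderiv_pow, map_add, pderiv_zero_sqDist,
    pderiv_one_sqDist, hk, hk2, pderiv_X_self, map_sub, pderiv_C, Nat.add_sub_cancel,
    show k + 1 + 1 - 1 = k + 1 from rfl]
  push_cast
  have : sqDist c ^ (k + 1) * 4 = sqDist c ^ k * (4 * ((X 0 - C c) ^ 2 + X 1 ^ 2)) := by
    rw [pow_succ, sqDist]; ring
  simp only [pow_succ]
  simp only [sqDist]
  ring

/-- A polynomial in one variable is zero if all its derivatives vanish at one point. -/
theorem eq_zero_of_iterate_derivative_eval_eq_zero [CharZero K] (p : Polynomial K) (a : K)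
    (h : ∀ j : ℕ, (Polynomial.derivative^[j] p).eval a = 0) : p = 0 := by
  classical
  by_contra hp
  have := (Polynomial.lt_rootMultiplicity_iff_isRoot_iterate_derivative
    (n := p.natDegree) (t := a) hp).2 (fun m _ => h m)
  have h2 := (Multiset.count_le_card a p.roots).trans (Polynomial.card_roots' p)
  rw [Polynomial.count_roots] at h2
  omega

/-- Restriction of a polynomial to the line `X₀ = a`. -/
def restrictVert (a : K) : MvPolynomial (Fin 2) K →ₐ[K] Polynomial K :=
  aeval ![Polynomial.C a, Polynomial.X]

/-- Restriction of a polynomial to the line `X₁ = b`. -/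
def restrictHoriz (b : K) : MvPolynomial (Fin 2) K →ₐ[K] Polynomial K :=
  aeval ![Polynomial.X, Polynomial.C b]

theorem restrictVert_pderiv (a : K) (p : MvPolynomial (Fin 2) K) :
    restrictVert a (pderiv 1 p) = Polynomial.derivative (restrictVert a p) := by
  induction p using MvPolynomial.induction_on with
  | C r => simp [restrictVert]
  | add p q hp hq => simp [hp, hq]
  | mul_X p i hp =>
    fin_cases i <;> simp [hp] <;> simp [restrictVert] <;> ring

theorem restrictHoriz_pderiv (b : K) (p : MvPolynomial (Fin 2) K) :
    restrictHoriz b (pderiv 0 p) = Polynomial.derivative (restrictHoriz b p) := by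
  induction p using MvPolynomial.induction_on with
  | C r => simp [restrictHoriz]
  | add p q hp hq => simp [hp, hq]
  | mul_X p i hp =>
    fin_cases i <;> simp [hp] <;> simp [restrictHoriz] <;> ring

theorem eval_restrictVert (a b : K) (p : MvPolynomial (Fin 2) K) :
    (restrictVert a p).eval b = eval ![a, b] p := by
  induction p using MvPolynomial.induction_on with
  | C r => simp [restrictVert]
  | add p q hp hq => simp [hp, hq]
  | mul_X p i hp =>
    fin_cases i <;> simp [hp] <;> simp [restrictVert]

theorem eval_restrictHoriz (a b : K) (p : MvPolynomial (Fin 2) K) :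
    (restrictHoriz b p).eval a = eval ![a, b] p := by
  induction p using MvPolynomial.induction_on with
  | C r => simp [restrictHoriz]
  | add p q hp hq => simp [hp, hq]
  | mul_X p i hp =>
    fin_cases i <;> simp [hp] <;> simp [restrictHoriz]

/-- Uniqueness in the Cauchy problem for harmonic polynomials with data on a line. -/
theorem eq_zero_of_planeLaplacian_eq_zero [CharZero K] (a : K) (h : MvPolynomial (Fin 2) K)
    (hΔ : planeLaplacian K h = 0) (h0 : restrictVert a h = 0)
    (h1 : restrictVert a (pderiv 0 h) = 0) : h = 0 := by
  have key : ∀ j : ℕ, ∀ g : MvPolynomial (Fin 2) K, planeLaplacian K g = 0 →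
      restrictVert a g = 0 → restrictVert a (pderiv 0 g) = 0 →
      restrictVert a ((pderiv 0)^[j] g) = 0 := by
    intro j
    induction j with
    | zero => exact fun g _ h _ => h
    | succ j ih =>
      intro g hg hg0 hg1
      rw [Function.iterate_succ_apply]
      have hc : pderiv 0 (pderiv 0 g) = - pderiv 1 (pderiv 1 g) :=
        eq_neg_of_add_eq_zero_left hg
      refine ih _ ?_ hg1 ?_
      · rw [planeLaplacian_apply, pderiv_one_zero_comm, pderiv_one_zero_comm, ← map_add,
          ← planeLaplacian_apply, hg, map_zero]
      · rw [hc, map_neg, restrictVert_pderiv, restrictVert_pderiv, hg0]; simp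
  refine MvPolynomial.funext fun x => ?_
  have hx : x = ![x 0, x 1] := by ext i; fin_cases i <;> rfl
  rw [hx, ← eval_restrictHoriz, eq_zero_of_iterate_derivative_eval_eq_zero
    (restrictHoriz (x 1) h) a, Polynomial.eval_zero, map_zero]
  intro j
  have hj : ∀ (j : ℕ) (g : MvPolynomial (Fin 2) K),
      Polynomial.derivative^[j] (restrictHoriz (x 1) g) =
        restrictHoriz (x 1) ((pderiv 0)^[j] g) := by
    intro j
    induction j with
    | zero => exact fun _ => rfl
    | succ j ih => intro g; rw [Function.iterate_succ_apply, Function.iterate_succ_apply, ← ih,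
        restrictHoriz_pderiv]
  rw [hj, eval_restrictHoriz, ← eval_restrictVert, key j h hΔ h0 h1, Polynomial.eval_zero]

theorem natDegree_restrictVert_le (a : K) (p : MvPolynomial (Fin 2) K) :
    (restrictVert a p).natDegree ≤ p.totalDegree := by
  have := aeval_natDegree_le (m := p.totalDegree) (n := 1) p le_rfl ![Polynomial.C a, Polynomial.X]
    (by intro i; fin_cases i <;> simp)
  simpa [restrictVert] using this

/-- The line `X₀ = c / 2` consists of the points equidistant from `(0, 0)` and `(c, 0)`, so the two
squared distances have the same restriction to it, a polynomial of degree two. -/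
theorem restrictVert_mul_pow_eq_zero {c : K} {A B h : MvPolynomial (Fin 2) K} {k : ℕ} [CharZero K]
    (hh : h = A * sqDist 0 ^ k + B * sqDist c ^ k) (hd : h.totalDegree < 2 * k) :
    restrictVert (c / 2) h = 0 := by
  set s : Polynomial K := Polynomial.X ^ 2 + Polynomial.C (c ^ 2 / 4) with hs
  have e0 : restrictVert (c / 2) (sqDist 0) = s := by
    simp [restrictVert, sqDist, hs, ← Polynomial.C_pow, div_pow, add_comm]
    norm_num
  have e1 : restrictVert (c / 2) (sqDist c) = s := by
    have : c / 2 - c = - (c / 2) := by ring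
    simp [restrictVert, sqDist, hs, ← Polynomial.C_sub, this, ← Polynomial.C_pow, div_pow, add_comm]
    norm_num
  have hdvd : s ^ k ∣ restrictVert (c / 2) h := by
    rw [hh, map_add, map_mul, map_mul, map_pow, map_pow, e0, e1, ← add_mul]
    exact dvd_mul_left _ _
  refine Polynomial.eq_zero_of_dvd_of_natDegree_lt hdvd ?_
  have : (s ^ k).natDegree = 2 * k := by
    rw [Polynomial.natDegree_pow, hs, Polynomial.natDegree_X_pow_add_C, mul_comm]
  rw [this]
  exact (natDegree_restrictVert_le _ _).trans_lt hd

/-- A polynomial of degree at most `2 k` in the ideal generated by the `(k + 1)`-st powers of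
the squared distances to two points is zero. -/
theorem eq_zero_of_mem_sqDist_pow [CharZero K] (c : K) (k : ℕ) :
    ∀ {A B h : MvPolynomial (Fin 2) K}, h = A * sqDist 0 ^ (k + 1) + B * sqDist c ^ (k + 1) →
      h.totalDegree ≤ 2 * k → h = 0 := by
  induction k with
  | zero =>
    intro A B h hh hd
    have h0 := restrictVert_mul_pow_eq_zero hh (by omega)
    rw [totalDegree_eq_zero_iff_eq_C.1 (Nat.le_zero.1 hd)] at h0 ⊢
    simpa [restrictVert] using h0
  | succ k ih =>
    intro A B h hh hd
    refine eq_zero_of_planeLaplacian_eq_zero (c / 2) h ?_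
      (restrictVert_mul_pow_eq_zero hh (by omega)) ?_
    · obtain ⟨A', hA⟩ := exists_planeLaplacian_mul_pow_succ (0 : K) A (k + 1)
      obtain ⟨B', hB⟩ := exists_planeLaplacian_mul_pow_succ c B (k + 1)
      refine ih (A := A') (B := B') (by rw [hh, map_add, hA, hB]) ?_
      have hle (i : Fin 2) : (pderiv i (pderiv i h)).totalDegree ≤ 2 * k := by
        have h1 := totalDegree_pderiv_le i (pderiv i h)
        have h2 := totalDegree_pderiv_le i h
        omega
      exact (totalDegree_add _ _).trans (max_le (hle 0) (hle 1))
    · obtain ⟨A', hA⟩ := exists_pderiv_mul_pow_succ 0 A (sqDist (0 : K)) (k + 1)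
      obtain ⟨B', hB⟩ := exists_pderiv_mul_pow_succ 0 B (sqDist c) (k + 1)
      refine restrictVert_mul_pow_eq_zero (A := A') (B := B') (k := k + 1)
        (by rw [hh, map_add, hA, hB]) ?_
      have := totalDegree_pderiv_le 0 h
      omega

end PlanePolynomials

/-! ### Divided powers of linear forms -/

section DividedPowers
open MvPolynomial
open scoped Nat

variable {K : Type*} [Field K]

/-- The linear polynomial `z₀ X₀ + z₁ X₁`. -/
def linPoly (z : Fin 2 → K) : MvPolynomial (Fin 2) K := C (z 0) * X 0 + C (z 1) * X 1

/-- The divided power `(z₀ X₀ + z₁ X₁)^(a - k) / (a - k)!`, read as `0` if `a < k`: the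
`k`-th derivative of `t ↦ t^a / a!` at `t = z₀ X₀ + z₁ X₁`. -/
def divPow (z : Fin 2 → K) (a k : ℕ) : MvPolynomial (Fin 2) K :=
  if k ≤ a then C ((((a - k)! : ℕ) : K)⁻¹) * linPoly z ^ (a - k) else 0

theorem divPow_zero_succ (z : Fin 2 → K) (k : ℕ) : divPow z 0 (k + 1) = 0 := by simp [divPow]

theorem divPow_succ_succ (z : Fin 2 → K) (a k : ℕ) :
    divPow z (a + 1) (k + 1) = divPow z a k := by simp [divPow]

theorem pderiv_linPoly (z : Fin 2 → K) (i : Fin 2) : pderiv i (linPoly z) = C (z i) := by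
  fin_cases i <;> simp [linPoly]

theorem pderiv_divPow [CharZero K] (z : Fin 2 → K) (a k : ℕ) (i : Fin 2) :
    pderiv i (divPow z a k) = C (z i) * divPow z a (k + 1) := by
  rcases lt_trichotomy a k with h | rfl | h
  · simp [divPow, h.not_ge, (h.trans k.lt_succ_self).not_ge]
  · simp [divPow]
  · obtain ⟨b, rfl⟩ := Nat.exists_eq_add_of_lt h
    have e1 : k + b + 1 - k = b + 1 := by omega
    have e2 : k + b + 1 - (k + 1) = b := by omega
    simp only [divPow, e1, e2, if_pos (show k ≤ k + b + 1 by omega),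
      if_pos (show k + 1 ≤ k + b + 1 by omega), pderiv_C_mul, pderiv_pow, pderiv_linPoly,
      Nat.add_sub_cancel, Nat.factorial_succ]
    have : (((b + 1 : ℕ) : MvPolynomial (Fin 2) K)) = C ((b + 1 : ℕ) : K) := by simp
    rw [this]
    have hb : ((b + 1 : ℕ) : K) ≠ 0 := by exact_mod_cast b.succ_ne_zero
    have h3 : (C (((((b + 1) * b ! : ℕ)) : K)⁻¹) : MvPolynomial (Fin 2) K) * C ((b + 1 : ℕ) : K) =
        C (((b ! : ℕ) : K)⁻¹) := by
      rw [← C_mul]; congr 1; push_cast at hb ⊢; field_simp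
    linear_combination (linPoly z ^ b * C (z i)) * h3

theorem planeLaplacian_divPow [CharZero K] (z : Fin 2 → K) (a k : ℕ) :
    planeLaplacian K (divPow z a k) = (z 0 ^ 2 + z 1 ^ 2) • divPow z a (k + 2) := by
  rw [planeLaplacian_apply, pderiv_divPow, pderiv_divPow, pderiv_C_mul, pderiv_C_mul,
    pderiv_divPow, pderiv_divPow, smul_eq_C_mul]
  simp only [C_add, C_pow]
  ring

theorem planeLaplacian_pow_divPow [CharZero K] (z : Fin 2 → K) (m : ℕ) : ∀ a k : ℕ,
    (planeLaplacian K ^ m) (divPow z a k) = (z 0 ^ 2 + z 1 ^ 2) ^ m • divPow z a (k + 2 * m) := by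
  induction m with
  | zero => intro a k; simp
  | succ m ih =>
    intro a k
    rw [pow_succ, Module.End.mul_apply, planeLaplacian_divPow, map_smul, ih, smul_smul,
      ← pow_succ', show k + 2 + 2 * m = k + 2 * (m + 1) by ring]

/-- The binomial theorem for divided powers. -/
theorem sum_divPow_mul_divPow [CharZero K] (w z : Fin 2 → K) : ∀ d k : ℕ,
    ∑ ij ∈ Finset.HasAntidiagonal.antidiagonal d, divPow w ij.1 0 * divPow z ij.2 k =
      divPow (w + z) d k := by
  intro d k
  induction k generalizing d with
  | zero =>
    have h : linPoly (w + z) = linPoly w + linPoly z := by simp [linPoly]; ring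
    simp only [divPow, Nat.zero_le, if_true, Nat.sub_zero, h]
    rw [(Commute.all _ _).add_pow', Finset.mul_sum]
    refine Finset.sum_congr rfl fun ij hij => ?_
    obtain ⟨i, j⟩ := ij
    obtain rfl : i + j = d := by simpa using hij
    have hc := Nat.add_choose_mul_factorial_mul_factorial i j
    rw [← Nat.choose_symm_add] at hc
    have hc' : (((i + j).choose i : ℕ) : K) * (i ! : ℕ) * (j ! : ℕ) = ((i + j)! : ℕ) := by
      exact_mod_cast hc
    have hi : ((i ! : ℕ) : K) ≠ 0 := by exact_mod_cast i.factorial_ne_zero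
    have hj : ((j ! : ℕ) : K) ≠ 0 := by exact_mod_cast j.factorial_ne_zero
    have hij : (((i + j)! : ℕ) : K) ≠ 0 := by exact_mod_cast (i + j).factorial_ne_zero
    have h3 : (C (((i + j)! : ℕ) : K)⁻¹ : MvPolynomial (Fin 2) K) * C (((i + j).choose i : ℕ) : K) =
        C (((i ! : ℕ) : K)⁻¹) * C (((j ! : ℕ) : K)⁻¹) := by
      rw [← C_mul, ← C_mul]; congr 1; field_simp; linear_combination hc'
    have h4 : (((i + j).choose i : ℕ) : MvPolynomial (Fin 2) K) =
      C (((i + j).choose i : ℕ) : K) := by simp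
    simp only [nsmul_eq_mul, h4]
    linear_combination (-(linPoly w ^ i * linPoly z ^ j)) * h3
  | succ k ih =>
    cases d with
    | zero => simp [divPow_zero_succ]
    | succ d =>
      rw [Finset.Nat.sum_antidiagonal_succ']
      simp only [divPow_zero_succ, divPow_succ_succ, mul_zero, zero_add, ih]

/-- The coefficients of a divided power are polynomials in `z`. -/
theorem exists_divPow_eq_sum (a k : ℕ) : ∃ w : ℕ → MvPolynomial (Fin 2) K, ∀ z : Fin 2 → K,
    divPow z a k = ∑ i ∈ Finset.range (a + 1), (z 0 ^ i * z 1 ^ (a - k - i)) • w i := by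
  by_cases h : k ≤ a
  · refine ⟨fun i => if i ≤ a - k then C ((((a - k)! : ℕ) : K)⁻¹) *
      (((a - k).choose i : MvPolynomial (Fin 2) K) * (X 0 ^ i * X 1 ^ (a - k - i)))
      else 0, fun z => ?_⟩
    rw [divPow, if_pos h, linPoly, add_pow, Finset.mul_sum]
    refine (Finset.sum_congr rfl fun i hi => ?_).trans (Finset.sum_subset
      (Finset.range_subset_range.2 (show a - k + 1 ≤ a + 1 by omega)) fun i _ hi => ?_)
    · have hi' : i ≤ a - k := by simpa [Nat.lt_succ_iff] using hi
      simp only [if_pos hi', smul_eq_C_mul, C_mul, C_pow, mul_pow]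
      ring
    · have hi' : ¬ i ≤ a - k := by simpa [Nat.lt_succ_iff] using hi
      simp only [if_neg hi', smul_zero]
  · exact ⟨0, fun z => by simp [divPow, h]⟩

end DividedPowers

/-! ### Polynomial functions of two coordinates -/

section PlaneFunctions
open MvPolynomial

variable {𝕜 : Type*} [RCLike 𝕜] {E : Type*} [NormedAddCommGroup E] [InnerProductSpace ℝ E]

/-- The `𝕜`-valued linear form `x ↦ ⟪θ, x⟫`. -/
def innerForm (𝕜 : Type*) [RCLike 𝕜] {E : Type*} [NormedAddCommGroup E]
    [InnerProductSpace ℝ E] (θ : E) :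
    E →L[ℝ] 𝕜 :=
  RCLike.ofRealCLM ∘L innerSL ℝ θ

theorem innerForm_apply (θ x : E) :
    innerForm 𝕜 θ x = ((inner ℝ θ x : ℝ) : 𝕜) := rfl

/-- A polynomial in two variables as a function on `E`: the variables are evaluated at the
coordinates `⟪f 0, x⟫` and `⟪f 1, x⟫`. -/
def planeEval (f : Fin 2 → E) :
    MvPolynomial (Fin 2) 𝕜 →ₐ[𝕜] (E → 𝕜) :=
  aeval fun i x => innerForm 𝕜 (f i) x

variable (f : Fin 2 → E)

theorem contDiff_planeEval (p : MvPolynomial (Fin 2) 𝕜) : ContDiff ℝ ∞ (planeEval f p) := by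
  induction p using MvPolynomial.induction_on with
  | C r =>
    have : planeEval f (C r) = fun _ => r := by ext; simp [planeEval]
    rw [this]; exact contDiff_const
  | add p q hp hq => rw [map_add]; exact hp.add hq
  | mul_X p i hp =>
    rw [map_mul]; refine hp.mul ?_
    simpa [planeEval] using (innerForm 𝕜 (f i)).contDiff

theorem hasFDerivAt_planeEval (p : MvPolynomial (Fin 2) 𝕜) (x : E) :
    HasFDerivAt (planeEval f p) (∑ i, planeEval f (pderiv i p) x • innerForm 𝕜 (f i)) x := by
  induction p using MvPolynomial.induction_on with
  | C r =>
    have : planeEval f (C r) = fun _ => r := by ext; simp [planeEval]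
    rw [this]
    refine (hasFDerivAt_const r x).congr_fderiv ?_
    ext w
    simp
  | add p q hp hq =>
    rw [map_add]
    refine (hp.add hq).congr_fderiv ?_
    ext w
    simp [add_mul]
    ring
  | mul_X p i hp =>
    rw [map_mul]
    have hX : planeEval f (X i : MvPolynomial (Fin 2) 𝕜) = fun x => innerForm 𝕜 (f i) x := by
      simp [planeEval]
    have h2 : HasFDerivAt (planeEval f (X i : MvPolynomial (Fin 2) 𝕜)) (innerForm 𝕜 (f i)) x := by
      rw [hX]; exact (innerForm 𝕜 (f i)).hasFDerivAt
    refine (hp.mul h2).congr_fderiv ?_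
    ext w
    fin_cases i <;> simp <;> ring

/-- In an orthonormal frame, the Laplacian of a polynomial in the two coordinates is the plane
Laplacian of the polynomial. -/
theorem laplacian_planeEval [FiniteDimensional ℝ E] (hf : Orthonormal ℝ f)
    (p : MvPolynomial (Fin 2) 𝕜) :
    Laplacian.laplacian (planeEval f p) = planeEval f (planeLaplacian 𝕜 p) := by
  let b := stdOrthonormalBasis ℝ E
  rw [InnerProductSpace.laplacian_eq_iteratedFDeriv_orthonormalBasis _ b]
  funext x
  have hd : fderiv ℝ (planeEval f p) =
      fun y => ∑ i, planeEval f (pderiv i p) y • innerForm 𝕜 (f i) :=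
    funext fun y => (hasFDerivAt_planeEval f p y).fderiv
  have hdd : HasFDerivAt (fderiv ℝ (planeEval f p)) (∑ i, (∑ j, planeEval f
      (pderiv j (pderiv i p)) x • innerForm 𝕜 (f j)).smulRight (innerForm 𝕜 (f i))) x := by
    rw [hd]
    exact HasFDerivAt.fun_sum fun i _ => (hasFDerivAt_planeEval f (pderiv i p) x).smul_const
      (innerForm 𝕜 (f i))
  have hb (i j : Fin 2) : ∑ k, (innerForm 𝕜 (f i) (b k)) * innerForm 𝕜 (f j) (b k) =
      if i = j then 1 else 0 := by
    have h1 := b.sum_inner_mul_inner (f i) (f j)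
    rw [orthonormal_iff_ite.1 hf i j] at h1
    have h2 : ∑ k, (innerForm 𝕜 (f i) (b k)) * innerForm 𝕜 (f j) (b k) =
        ((∑ k, inner ℝ (f i) (b k) * inner ℝ (b k) (f j) : ℝ) : 𝕜) := by
      push_cast
      refine Finset.sum_congr rfl fun k _ => ?_
      rw [innerForm_apply, innerForm_apply, real_inner_comm (f j)]
    rw [h2, h1]
    split_ifs <;> simp
  have hs : ∀ k, iteratedFDeriv ℝ 2 (planeEval f p) x ![b k, b k] =
      ∑ i, ∑ j, planeEval f (pderiv j (pderiv i p)) x *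
        (innerForm 𝕜 (f j) (b k) * innerForm 𝕜 (f i) (b k)) := by
    intro k
    rw [iteratedFDeriv_two_apply, hdd.fderiv]
    simp [add_mul, mul_assoc]
  simp only [hs]
  rw [Finset.sum_comm]
  have : ∀ i, ∑ k, ∑ j, planeEval f (pderiv j (pderiv i p)) x *
        (innerForm 𝕜 (f j) (b k) * innerForm 𝕜 (f i) (b k)) =
      planeEval f (pderiv i (pderiv i p)) x := by
    intro i
    rw [Finset.sum_comm]
    simp only [← Finset.mul_sum, hb]
    simp
  rw [Finset.sum_congr rfl fun i _ => this i]
  simp only [Fin.sum_univ_two, planeLaplacian_apply, map_add, Pi.add_apply]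

theorem iterate_laplacian_planeEval [FiniteDimensional ℝ E] (hf : Orthonormal ℝ f) (m : ℕ) :
    ∀ p : MvPolynomial (Fin 2) 𝕜,
      Laplacian.laplacian^[m] (planeEval f p) = planeEval f ((planeLaplacian 𝕜 ^ m) p) := by
  induction m with
  | zero => intro p; rfl
  | succ m ih =>
    intro p
    rw [Function.iterate_succ_apply, laplacian_planeEval f hf, ih, pow_succ]; rfl

/-- The linear form `z₀ ⟪f 0, ·⟫ + z₁ ⟪f 1, ·⟫`. -/
def planeForm (z : Fin 2 → 𝕜) : E →L[ℝ] 𝕜 :=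
  ∑ i, z i • innerForm 𝕜 (f i)

/-- The tensor power `φ ⊗ ⋯ ⊗ φ` of a linear form. -/
def tensorPow (φ : E →L[ℝ] 𝕜) (p : ℕ) :
    E [×p]→L[ℝ] 𝕜 :=
  (ContinuousMultilinearMap.mkPiAlgebra ℝ (Fin p) 𝕜).compContinuousLinearMap fun _ => φ

theorem tensorPow_apply (φ : E →L[ℝ] 𝕜) (p : ℕ)
    (w : Fin p → E) : tensorPow φ p w = ∏ i, φ (w i) := by
  simp [tensorPow]

theorem iteratedFDeriv_planeEval_divPow (z : Fin 2 → 𝕜) (a k : ℕ) :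
    iteratedFDeriv ℝ k (planeEval f (divPow z a 0)) =
      fun x => planeEval f (divPow z a k) x • tensorPow (planeForm f z) k := by
  induction k with
  | zero => ext x w; simp [tensorPow_apply]
  | succ k ih =>
    ext x w
    have hd : HasFDerivAt (fun x => planeEval f (divPow z a k) x • tensorPow (planeForm f z) k)
        ((∑ i, planeEval f (pderiv i (divPow z a k)) x • innerForm 𝕜 (f i)).smulRight
          (tensorPow (planeForm f z) k)) x :=
      (hasFDerivAt_planeEval f (divPow z a k) x).smul_const (tensorPow (planeForm f z) k)
    rw [iteratedFDeriv_succ_apply_left, ih, hd.fderiv]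
    simp [pderiv_divPow, tensorPow_apply, Fin.prod_univ_succ, planeForm, planeEval, Fin.tail]
    ring

end PlaneFunctions

/-! ### Bilinear forms vanishing on a kernel -/

section BilinearSplitting

/-- A bilinear form vanishing on `ker T × ker T` is a sum of a form that factors through `T` in
the first variable and one that factors through `T` in the second variable. -/
theorem exists_bilin_eq_add_of_ker {K V : Type*} [Field K] [AddCommGroup V] [Module K V]
    (T : V →ₗ[K] V) (B : V →ₗ[K] V →ₗ[K] K) (hB : ∀ v u, T v = 0 → T u = 0 → B v u = 0) :
    ∃ B₁ B₂ : V →ₗ[K] V →ₗ[K] K, ∀ v u, B v u = B₁ (T v) u + B₂ v (T u) := by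
  -- a right inverse `R` of `T` on its range, so that `v - R (T v)` lies in `ker T`
  obtain ⟨g, hg⟩ := T.rangeRestrict.exists_rightInverse_of_surjective T.range_rangeRestrict
  obtain ⟨R, hR⟩ := LinearMap.exists_extend g
  have hTR : ∀ x, T (R (T x)) = T x := by
    intro x
    have h1 : R (T x) = g ⟨T x, LinearMap.mem_range_self T x⟩ :=
      (LinearMap.congr_fun hR ⟨T x, LinearMap.mem_range_self T x⟩)
    have h2 := LinearMap.congr_fun hg ⟨T x, LinearMap.mem_range_self T x⟩
    rw [h1]
    exact congrArg Subtype.val h2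
  refine ⟨B ∘ₗ R, (B ∘ₗ (LinearMap.id - R ∘ₗ T)).compl₂ R, fun v u => ?_⟩
  have h := hB (v - R (T v)) (u - R (T u)) (by simp [hTR]) (by simp [hTR])
  simp only [map_sub, LinearMap.sub_apply] at h
  simp only [LinearMap.comp_apply, LinearMap.compl₂_apply, LinearMap.sub_apply, LinearMap.id_apply,
    map_sub]
  linear_combination h

open MvPolynomial in
/-- A bilinear form evaluated at divided powers of `(c, 0) - x` and of `x` is a polynomial in
`x`. -/
theorem exists_eval_eq_bilin_divPow {K : Type*} [Field K]
    (β : MvPolynomial (Fin 2) K →ₗ[K] MvPolynomial (Fin 2) K →ₗ[K] K) (c : K) (a k b l : ℕ) :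
    ∃ P : MvPolynomial (Fin 2) K, ∀ x : Fin 2 → K,
      eval x P = β (divPow (![c, 0] - x) b l) (divPow x a k) := by
  obtain ⟨w, hw⟩ := exists_divPow_eq_sum (K := K) a k
  obtain ⟨w', hw'⟩ := exists_divPow_eq_sum (K := K) b l
  refine ⟨∑ i ∈ Finset.range (b + 1), ∑ j ∈ Finset.range (a + 1),
    (C c - X 0) ^ i * (-X 1) ^ (b - l - i) * (X 0 ^ j * X 1 ^ (a - k - j) * C (β (w' i) (w j))),
    fun x => ?_⟩
  rw [hw, hw']
  simp only [map_sum, map_smul, LinearMap.sum_apply, LinearMap.smul_apply, Finset.mul_sum,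
    smul_eq_mul]
  rw [Finset.sum_comm]
  refine Finset.sum_congr rfl fun j _ => Finset.sum_congr rfl fun i _ => ?_
  simp
  ring

theorem eq_zero_of_forall_sum_pow_mul_eq_zero {K : Type*} [Field K] [CharZero K] {N : ℕ}
    (c : Fin N → K) (h : ∀ r : K, ∑ p : Fin N, r ^ (p : ℕ) * c p = 0) (p : Fin N) : c p = 0 := by
  have hP : (∑ p : Fin N, Polynomial.C (c p) * Polynomial.X ^ (p : ℕ)) = 0 := by
    refine Polynomial.funext fun r => ?_
    rw [Polynomial.eval_zero, ← h r, Polynomial.eval_finsetSum]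
    exact Finset.sum_congr rfl fun p _ => by
      rw [Polynomial.eval_mul, Polynomial.eval_C, Polynomial.eval_pow, Polynomial.eval_X, mul_comm]
  have := congrArg (fun P => Polynomial.coeff P p) hP
  simpa [Polynomial.finsetSum_coeff, Polynomial.coeff_C_mul, Polynomial.coeff_X_pow,
    Fin.val_inj] using this

end BilinearSplitting

/-! ### Tensor fields and products of derivatives -/

section TensorFields

variable {𝕜 : Type*} [RCLike 𝕜] {n : ℕ}

/-- The symmetrization `(p!)⁻¹ ∑ T ∘ σ` of a tensor. -/
def symmetrize (𝕜 : Type*) [RCLike 𝕜] (n p : ℕ) :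
    ((EuclideanSpace ℝ (Fin n)) [×p]→L[ℝ] 𝕜) →L[ℝ] ((EuclideanSpace ℝ (Fin n)) [×p]→L[ℝ] 𝕜) :=
  ((p.factorial : ℕ) : ℝ)⁻¹ • ∑ σ : Equiv.Perm (Fin p), (ContinuousMultilinearMap.domDomCongrₗᵢ ℝ
    (EuclideanSpace ℝ (Fin n)) 𝕜 σ).toContinuousLinearEquiv.toContinuousLinearMap

theorem symmetrize_apply {p : ℕ} (T : (EuclideanSpace ℝ (Fin n)) [×p]→L[ℝ] 𝕜)
    (w : Fin p → EuclideanSpace ℝ (Fin n)) :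
    symmetrize 𝕜 n p T w = ((p.factorial : ℕ) : ℝ)⁻¹ • ∑ σ : Equiv.Perm (Fin p), T (w ∘ σ) := by
  simp [symmetrize]
  rfl

theorem symmetrize_comp_perm {p : ℕ} (T : (EuclideanSpace ℝ (Fin n)) [×p]→L[ℝ] 𝕜)
    (σ : Equiv.Perm (Fin p)) (w : Fin p → EuclideanSpace ℝ (Fin n)) :
    symmetrize 𝕜 n p T (w ∘ σ) = symmetrize 𝕜 n p T w := by
  rw [symmetrize_apply, symmetrize_apply]
  congr 1
  exact Fintype.sum_equiv (Equiv.mulLeft σ) _ _ fun τ => rfl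

theorem symmetrize_eq_self {p : ℕ} {T : (EuclideanSpace ℝ (Fin n)) [×p]→L[ℝ] 𝕜}
    (hT : ∀ (σ : Equiv.Perm (Fin p)) (w : Fin p → EuclideanSpace ℝ (Fin n)), T (w ∘ σ) = T w) :
    symmetrize 𝕜 n p T = T := by
  ext w
  rw [symmetrize_apply]
  simp only [hT, Finset.sum_const, Finset.card_univ, Fintype.card_perm, Fintype.card_fin]
  rw [← Nat.cast_smul_eq_nsmul ℝ, smul_smul, inv_mul_cancel₀, one_smul]
  exact_mod_cast p.factorial_ne_zero

theorem symmetrize_smul {p : ℕ} (c : 𝕜) (T : (EuclideanSpace ℝ (Fin n)) [×p]→L[ℝ] 𝕜) :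
    symmetrize 𝕜 n p (c • T) = c • symmetrize 𝕜 n p T := by
  ext w
  simp only [smul_apply, symmetrize_apply, ← Finset.smul_sum]
  rw [smul_comm]

theorem symmetrize_tensorPow {p : ℕ} (φ : EuclideanSpace ℝ (Fin n) →L[ℝ] 𝕜) :
    symmetrize 𝕜 n p (tensorPow φ p) = tensorPow φ p :=
  symmetrize_eq_self fun σ w => by
    rw [tensorPow_apply, tensorPow_apply]
    exact Fintype.prod_equiv σ _ _ fun i => rfl

/-- The space of smooth `𝕜`-valued functions on `ℝⁿ`. -/
def smoothFunctions (𝕜 : Type*) [RCLike 𝕜] (n : ℕ) :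
    Submodule 𝕜 (EuclideanSpace ℝ (Fin n) → 𝕜) where
  carrier := {u | ContDiff ℝ ∞ u}
  add_mem' := by
    intro u v (hu : ContDiff ℝ ∞ u) (hv : ContDiff ℝ ∞ v)
    exact hu.add hv
  zero_mem' := (contDiff_const : ContDiff ℝ ∞ fun _ => (0 : 𝕜))
  smul_mem' := by
    intro c u (hu : ContDiff ℝ ∞ u)
    exact hu.const_smul c

theorem contDiff_smoothFunctions (u : smoothFunctions 𝕜 n) : ContDiff ℝ ∞ u.1 := u.2

variable (Ω : Set (EuclideanSpace ℝ (Fin n)))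

theorem SymTensorField.ext {Ω : Set (EuclideanSpace ℝ (Fin n))} {p : ℕ}
    {F G : SymTensorField 𝕜 Ω p} (h : ∀ x, F.1 x = G.1 x) : F = G :=
  Subtype.ext (funext h)

/-- The symmetric tensor field `a ⊗ Sym T` for a smooth function `a` and a constant tensor `T`. -/
def tensorField (p : ℕ) : smoothFunctions 𝕜 n →ₗ[𝕜]
    ((EuclideanSpace ℝ (Fin n)) [×p]→L[ℝ] 𝕜) →ₗ[𝕜] SymTensorField 𝕜 Ω p :=
  LinearMap.mk₂ 𝕜
    (fun a T => ⟨fun x => a.1 x • symmetrize 𝕜 n p T,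
      ⟨fun x => a.1 x • symmetrize 𝕜 n p T, (contDiff_smoothFunctions a).smul contDiff_const,
        fun _ => rfl⟩,
      fun x σ w => by simp [symmetrize_comp_perm]⟩)
    (fun a b T => SymTensorField.ext fun x => add_smul (a.1 x) (b.1 x) (symmetrize 𝕜 n p T))
    (fun c a T => SymTensorField.ext fun x => mul_smul c (a.1 x) (symmetrize 𝕜 n p T))
    (fun a S T => SymTensorField.ext fun x => by
      change a.1 x • symmetrize 𝕜 n p (S + T) =
        a.1 x • symmetrize 𝕜 n p S + a.1 x • symmetrize 𝕜 n p T
      rw [map_add, smul_add])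
    (fun c a T => SymTensorField.ext fun x => by
      change a.1 x • symmetrize 𝕜 n p (c • T) = c • (a.1 x • symmetrize 𝕜 n p T)
      rw [symmetrize_smul, smul_comm])

theorem tensorField_apply {p : ℕ} (a : smoothFunctions 𝕜 n)
    (T : (EuclideanSpace ℝ (Fin n)) [×p]→L[ℝ] 𝕜) (x : closure Ω) :
    (tensorField Ω p a T).1 x = a.1 x • symmetrize 𝕜 n p T := rfl

/-- `derivativeProduct` as a bilinear map; `v` is the first variable and `u` the second. -/
def derivativeProductBilin (M : ℕ) :
    smoothFunctions 𝕜 n →ₗ[𝕜] smoothFunctions 𝕜 n →ₗ[𝕜] SymTensorFields 𝕜 Ω M :=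
  LinearMap.mk₂ 𝕜 (fun v u => derivativeProduct Ω M u.1 v.1 u.2 v.2)
    (fun v w u => funext fun p => SymTensorField.ext fun x =>
      add_smul (v.1 x) (w.1 x) (iteratedFDeriv ℝ p u.1 x))
    (fun c v u => funext fun p => SymTensorField.ext fun x =>
      mul_smul c (v.1 x) (iteratedFDeriv ℝ p u.1 x))
    (fun v u w => funext fun p => SymTensorField.ext fun x => by
      change v.1 x • iteratedFDeriv ℝ p (u.1 + w.1) x =
        v.1 x • iteratedFDeriv ℝ p u.1 x + v.1 x • iteratedFDeriv ℝ p w.1 x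
      rw [iteratedFDeriv_add_apply
        ((contDiff_smoothFunctions u).contDiffAt.of_le (by exact_mod_cast le_top))
        ((contDiff_smoothFunctions w).contDiffAt.of_le (by exact_mod_cast le_top)), smul_add])
    (fun c v u => funext fun p => SymTensorField.ext fun x => by
      change v.1 x • iteratedFDeriv ℝ p (c • u.1) x = c • (v.1 x • iteratedFDeriv ℝ p u.1 x)
      rw [iteratedFDeriv_const_smul_apply
        ((contDiff_smoothFunctions u).contDiffAt.of_le (by exact_mod_cast le_top)), smul_comm])

/-- `planeEval f`, with values in the smooth functions. -/
def planeSmooth (f : Fin 2 → EuclideanSpace ℝ (Fin n)) :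
    MvPolynomial (Fin 2) 𝕜 →ₗ[𝕜] smoothFunctions 𝕜 n :=
  (planeEval f).toLinearMap.codRestrict _ (contDiff_planeEval f)

theorem planeSmooth_coe (f : Fin 2 → EuclideanSpace ℝ (Fin n)) (q : MvPolynomial (Fin 2) 𝕜) :
    (planeSmooth f q).1 = planeEval f q := rfl

/-- Each derivative of a divided power of a linear form is a divided power times a tensor power of
the form. -/
theorem derivativeProductBilin_divPow (M : ℕ) (f : Fin 2 → EuclideanSpace ℝ (Fin n))
    (v : MvPolynomial (Fin 2) 𝕜) (z : Fin 2 → 𝕜) (a : ℕ) :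
    derivativeProductBilin Ω M (planeSmooth f v) (planeSmooth f (divPow z a 0)) =
      fun p : Fin (M + 1) =>
        tensorField Ω p (planeSmooth f (v * divPow z a p)) (tensorPow (planeForm f z) p) := by
  funext p
  refine SymTensorField.ext fun x => ?_
  rw [tensorField_apply, symmetrize_tensorPow]
  change planeEval f v x • iteratedFDeriv ℝ p (planeEval f (divPow z a 0)) x = _
  rw [iteratedFDeriv_planeEval_divPow, smul_smul, planeSmooth_coe, map_mul]
  rfl

/-- The coefficients of a tensor power of a linear form on a plane are polynomials of degree `p`
in the coefficients of the form. -/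
theorem exists_tensorPow_planeForm_eq_sum (f : Fin 2 → EuclideanSpace ℝ (Fin n)) (p : ℕ) :
    ∃ T : Finset (Fin p) → (EuclideanSpace ℝ (Fin n)) [×p]→L[ℝ] 𝕜, ∀ z : Fin 2 → 𝕜,
      tensorPow (planeForm f z) p = ∑ t, (z 0 ^ t.card * z 1 ^ (p - t.card)) • T t := by
  classical
  refine ⟨fun t => (ContinuousMultilinearMap.mkPiAlgebra ℝ (Fin p) 𝕜).compContinuousLinearMap
    fun i => if i ∈ t then innerForm 𝕜 (f 0) else innerForm 𝕜 (f 1), fun z => ?_⟩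
  ext w
  simp only [tensorPow_apply, planeForm, sum_apply, Fin.sum_univ_two,
    add_apply, smul_apply, smul_eq_mul]
  rw [Finset.prod_add, Finset.powerset_univ]
  refine Finset.sum_congr rfl fun t _ => ?_
  have h1 : ∏ i, (if i ∈ t then innerForm 𝕜 (f 0) else innerForm 𝕜 (f 1)) (w i) =
      (∏ i ∈ t, innerForm 𝕜 (f 0) (w i)) * ∏ i ∈ Finset.univ \ t, innerForm 𝕜 (f 1) (w i) := by
    rw [← Finset.prod_sdiff (Finset.subset_univ t), mul_comm]
    congr 1
    · exact Finset.prod_congr rfl fun i hi => by rw [if_pos hi]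
    · exact Finset.prod_congr rfl fun i hi => by rw [if_neg (Finset.mem_sdiff.1 hi).2]
  simp only [Finset.prod_mul_distrib, Finset.prod_const,
    ContinuousMultilinearMap.compContinuousLinearMap_apply,
    ContinuousMultilinearMap.mkPiAlgebra_apply, h1]
  rw [Finset.card_sdiff_of_subset (Finset.subset_univ t), Finset.card_univ, Fintype.card_fin]
  ring

end TensorFields

/-! ### Polyharmonic products of ridge functions -/

section RidgeFields
open MvPolynomial

variable {𝕜 : Type*} [RCLike 𝕜] {n : ℕ} (Ω : Set (EuclideanSpace ℝ (Fin n)))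

theorem derivativeProductBilin_mem_productSpan {f : Fin 2 → EuclideanSpace ℝ (Fin n)}
    (hf : Orthonormal ℝ f) (k : ℕ) {v u : MvPolynomial (Fin 2) 𝕜}
    (hv : (planeLaplacian 𝕜 ^ (k + 1)) v = 0) (hu : (planeLaplacian 𝕜 ^ (k + 1)) u = 0) :
    derivativeProductBilin Ω (2 * k) (planeSmooth f v) (planeSmooth f u) ∈
      productSpan 𝕜 Ω (2 * k) := by
  have hm : (2 * k + 2) / 2 = k + 1 := by omega
  refine Submodule.subset_span ⟨planeEval f u, planeEval f v, contDiff_planeEval f u,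
    contDiff_planeEval f v, ?_, ?_, rfl⟩
  · intro x _; rw [hm, iterate_laplacian_planeEval f hf, hu, map_zero]; rfl
  · intro x _; rw [hm, iterate_laplacian_planeEval f hf, hv, map_zero]; rfl

/-- A functional that kills all products `v ⊕ D^α u` of polyharmonic functions kills the sum over
`p` of the fields `⟪ξ, x⟫^(d - p) / (d - p)! ⊗ θ^{⊗ p}`, where `ξ = c • f 0` and `θ` is a vector of the
(complexified) plane. The sum equals `∑ v_i ⊕ D^α u_j`, where `v_i`, `u_j` are the divided powers of
`ξ - θ` and `θ` of total degree `d`. The value of the functional at the first expression is a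
polynomial in `θ` of degree at most `2 k`; by the second one, it lies in the ideal of the
`(k + 1)`-st powers of `|θ|²` and `|ξ - θ|²`. So it vanishes. -/
theorem sum_tensorField_divPow_eq_zero {f : Fin 2 → EuclideanSpace ℝ (Fin n)}
    (hf : Orthonormal ℝ f) (k : ℕ) (ψ : SymTensorFields 𝕜 Ω (2 * k) →ₗ[𝕜] 𝕜)
    (hψ : ∀ F ∈ productSpan 𝕜 Ω (2 * k), ψ F = 0) (c : 𝕜) (d : ℕ) (θ : Fin 2 → 𝕜) :
    ∑ p : Fin (2 * k + 1), ψ (Pi.single p (tensorField Ω p (planeSmooth f (divPow ![c, 0] d p))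
      (tensorPow (planeForm f θ) p))) = 0 := by
  -- the summands are polynomials `Q p` in `θ` of degree at most `2 k`
  let χ (p : Fin (2 * k + 1)) : ((EuclideanSpace ℝ (Fin n)) [×(p : ℕ)]→L[ℝ] 𝕜) →ₗ[𝕜] 𝕜 :=
    ψ ∘ₗ LinearMap.single 𝕜 (fun p : Fin (2 * k + 1) => SymTensorField 𝕜 Ω p) p ∘ₗ
      tensorField Ω p (planeSmooth f (divPow ![c, 0] d p))
  have hχ : ∀ p T, χ p T = ψ (Pi.single p (tensorField Ω p
    (planeSmooth f (divPow ![c, 0] d p)) T)) := fun p T => rfl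
  have hQ : ∀ p : Fin (2 * k + 1), ∃ Q : MvPolynomial (Fin 2) 𝕜, Q.totalDegree ≤ 2 * k ∧
      ∀ x, eval x Q = χ p (tensorPow (planeForm f x) p) := by
    intro p
    obtain ⟨T, hT⟩ := exists_tensorPow_planeForm_eq_sum (𝕜 := 𝕜) f p
    refine ⟨∑ t : Finset (Fin p), C (χ p (T t)) * (X 0 ^ t.card * X 1 ^ (p - t.card)), ?_, ?_⟩
    · refine totalDegree_finsetSum_le fun t _ => ?_
      have ht : t.card ≤ p := by simpa using t.card_le_univ
      have hp := p.2
      calc _ ≤ (C (χ p (T t)) : MvPolynomial (Fin 2) 𝕜).totalDegree +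
            (X 0 ^ t.card * X 1 ^ (p - t.card) : MvPolynomial (Fin 2) 𝕜).totalDegree :=
            totalDegree_mul _ _
        _ ≤ 0 + (t.card + (p - t.card)) := by
            gcongr
            · simp
            · refine (totalDegree_mul _ _).trans ?_
              simp [totalDegree_X_pow]
        _ ≤ 2 * k := by omega
    · intro x
      rw [hT, map_sum, map_sum]
      refine Finset.sum_congr rfl fun t _ => ?_
      rw [map_smul]
      simp
      ring
  choose Q hQd hQ using hQ
  let B : MvPolynomial (Fin 2) 𝕜 →ₗ[𝕜] MvPolynomial (Fin 2) 𝕜 →ₗ[𝕜] 𝕜 :=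
    ((derivativeProductBilin Ω (2 * k)).compl₁₂ (planeSmooth f) (planeSmooth f)).compr₂ ψ
  have hB : ∀ v u, B v u =
    ψ (derivativeProductBilin Ω (2 * k) (planeSmooth f v) (planeSmooth f u)) := fun v u => rfl
  obtain ⟨B₁, B₂, hB12⟩ := exists_bilin_eq_add_of_ker (planeLaplacian 𝕜 ^ (k + 1)) B
    fun v u hv hu => hψ _ (derivativeProductBilin_mem_productSpan Ω hf k hv hu)
  choose P₁ hP₁ using fun ij : ℕ × ℕ =>
    exists_eval_eq_bilin_divPow B₁ c ij.2 0 ij.1 (0 + 2 * (k + 1))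
  choose P₂ hP₂ using fun ij : ℕ × ℕ =>
    exists_eval_eq_bilin_divPow B₂ c ij.2 (0 + 2 * (k + 1)) ij.1 0
  have hsum : ∀ x : Fin 2 → 𝕜, ∑ p, χ p (tensorPow (planeForm f x) p) =
      ∑ ij ∈ Finset.HasAntidiagonal.antidiagonal d,
        B (divPow (![c, 0] - x) ij.1 0) (divPow x ij.2 0) := by
    intro x
    simp only [hB, derivativeProductBilin_divPow]
    rw [← map_sum]
    have hx : (∑ ij ∈ Finset.HasAntidiagonal.antidiagonal d, fun p : Fin (2 * k + 1) =>
        tensorField Ω p (planeSmooth f (divPow (![c, 0] - x) ij.1 0 * divPow x ij.2 p))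
          (tensorPow (planeForm f x) p)) = fun p : Fin (2 * k + 1) =>
        tensorField Ω p (planeSmooth f (divPow ![c, 0] d p)) (tensorPow (planeForm f x) p) := by
      funext p
      rw [Finset.sum_apply, ← LinearMap.sum_apply, ← map_sum, ← map_sum, sum_divPow_mul_divPow,
        sub_add_cancel]
    rw [hx]
    simp only [hχ]
    rw [← map_sum, Finset.univ_sum_single (fun p : Fin (2 * k + 1) =>
        tensorField Ω p (planeSmooth f (divPow ![c, 0] d p)) (tensorPow (planeForm f x) p))]
  have hpoly : ∑ p, Q p =
      (∑ ij ∈ Finset.HasAntidiagonal.antidiagonal d, P₂ ij) * sqDist 0 ^ (k + 1) +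
      (∑ ij ∈ Finset.HasAntidiagonal.antidiagonal d, P₁ ij) * sqDist c ^ (k + 1) := by
    refine MvPolynomial.funext fun x => ?_
    simp only [map_sum, map_add, map_mul, map_pow, hQ, hsum, hB12, planeLaplacian_pow_divPow,
      hP₁, hP₂, Finset.sum_mul, ← Finset.sum_add_distrib, map_smul, LinearMap.smul_apply]
    refine Finset.sum_congr rfl fun ij _ => ?_
    simp [sqDist]
    ring
  have h0 := eq_zero_of_mem_sqDist_pow c k hpoly
    (totalDegree_finsetSum_le fun p _ => hQd p)
  have := congrArg (eval θ) h0
  simpa only [map_sum, hQ, map_zero, hχ] using this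

theorem planeForm_smul (f : Fin 2 → EuclideanSpace ℝ (Fin n)) (r : 𝕜) (θ : Fin 2 → 𝕜) :
    planeForm f (r • θ) = r • planeForm f θ := by
  simp [planeForm, mul_smul]

theorem tensorPow_smul (r : 𝕜) (T : EuclideanSpace ℝ (Fin n) →L[ℝ] 𝕜) (p : ℕ) :
    tensorPow (r • T) p = r ^ p • tensorPow T p := by
  ext w; simp [tensorPow_apply, Finset.prod_mul_distrib]

/-- The orders `p` in `sum_tensorField_divPow_eq_zero` can be separated, so each of the summands
lies in the span. -/
theorem single_tensorField_divPow_mem {f : Fin 2 → EuclideanSpace ℝ (Fin n)}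
    (hf : Orthonormal ℝ f) (k : ℕ) (c : 𝕜) (j : ℕ) (p : Fin (2 * k + 1)) (θ : Fin 2 → 𝕜) :
    Pi.single p (tensorField Ω p (planeSmooth f (divPow ![c, 0] j 0))
      (tensorPow (planeForm f θ) p)) ∈ productSpan 𝕜 Ω (2 * k) := by
  by_contra hmem
  obtain ⟨ψ, hψ, hker⟩ := Submodule.exists_le_ker_of_notMem hmem
  refine hψ ?_
  -- scaling `θ` separates the orders
  have h := eq_zero_of_forall_sum_pow_mul_eq_zero (fun q : Fin (2 * k + 1) =>
    ψ (Pi.single q (tensorField Ω q (planeSmooth f (divPow ![c, 0] (j + p) q))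
      (tensorPow (planeForm f θ) q)))) (fun r => ?_) p
  · have hd : divPow ![c, 0] (j + p) p = divPow ![c, 0] j 0 := by simp [divPow]
    simpa only [hd] using h
  · refine Eq.trans ?_ (sum_tensorField_divPow_eq_zero Ω hf k ψ (fun F hF => hker hF) c (j + p)
      (r • θ))
    refine Finset.sum_congr rfl fun q _ => ?_
    rw [planeForm_smul, tensorPow_smul, map_smul, Pi.single_smul, map_smul, smul_eq_mul]

theorem exists_norm_eq_one_and_eq_smul {V : Type*} [NormedAddCommGroup V] [NormedSpace ℝ V]
    [Nontrivial V] (v : V) : ∃ (e : V) (c : ℝ), ‖e‖ = 1 ∧ v = c • e := by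
  by_cases hv : v = 0
  · obtain ⟨e, he⟩ := exists_norm_eq V (zero_le_one (α := ℝ))
    exact ⟨e, 0, he, by simp [hv]⟩
  · exact ⟨‖v‖⁻¹ • v, ‖v‖, norm_smul_inv_norm hv, by
      rw [smul_smul, mul_inv_cancel₀ (norm_ne_zero_iff.2 hv), one_smul]⟩

/-- Two vectors lie in a plane, and the first of them on the first axis of an orthonormal frame
of the plane. -/
theorem exists_orthonormal_frame (hn : 2 ≤ n) (ξ θ : EuclideanSpace ℝ (Fin n)) :
    ∃ (f : Fin 2 → EuclideanSpace ℝ (Fin n)) (c r s : ℝ), Orthonormal ℝ f ∧ ξ = c • f 0 ∧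
      θ = r • f 0 + s • f 1 := by
  have : Nontrivial (EuclideanSpace ℝ (Fin n)) :=
    Module.nontrivial_of_finrank_pos (R := ℝ) (by simp; omega)
  obtain ⟨e, c, he, hξ⟩ := exists_norm_eq_one_and_eq_smul ξ
  have hfin : Module.finrank ℝ (ℝ ∙ e)ᗮ = n - 1 := by
    have : Fact (Module.finrank ℝ (EuclideanSpace ℝ (Fin n)) = (n - 1) + 1) :=
      ⟨by simp; omega⟩
    exact Submodule.finrank_orthogonal_span_singleton (by rintro rfl; simp at he)
  have : Nontrivial (ℝ ∙ e)ᗮ := Module.nontrivial_of_finrank_pos (R := ℝ) (by omega)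
  have hee : inner ℝ e e = 1 := by rw [real_inner_self_eq_norm_sq, he, one_pow]
  obtain ⟨g, s, hg, hθ⟩ := exists_norm_eq_one_and_eq_smul (V := (ℝ ∙ e)ᗮ)
    ⟨θ - inner ℝ e θ • e, Submodule.mem_orthogonal_singleton_iff_inner_right.2 (by
      rw [inner_sub_right, inner_smul_right, hee, mul_one, sub_self])⟩
  have heg : inner ℝ e (g : EuclideanSpace ℝ (Fin n)) = 0 :=
    Submodule.mem_orthogonal_singleton_iff_inner_right.1 g.2
  refine ⟨![e, g], c, inner ℝ e θ, s, ?_, hξ, ?_⟩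
  · rw [orthonormal_iff_ite]
    have hgg : inner ℝ (g : EuclideanSpace ℝ (Fin n)) g = 1 := by
      rw [real_inner_self_eq_norm_sq, show ‖(g : EuclideanSpace ℝ (Fin n))‖ = 1 from hg, one_pow]
    intro i j
    fin_cases i <;> fin_cases j
    · exact hee
    · exact heg
    · exact (real_inner_comm _ _).trans heg
    · exact hgg
  · have := congrArg Subtype.val hθ
    simp at this
    simp [← this]

/-- The product of linear functions `∏ⱼ ⟪ξⱼ, x⟫`. -/
def prodInner (𝕜 : Type*) [RCLike 𝕜] {n k : ℕ} (ξ : Fin k → EuclideanSpace ℝ (Fin n)) :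
    smoothFunctions 𝕜 n :=
  ⟨fun x => ∏ j, innerForm 𝕜 (ξ j) x,
    (contDiff_prod fun j _ => (innerForm 𝕜 (ξ j)).contDiff :
      ContDiff ℝ ∞ fun x => ∏ j, innerForm 𝕜 (ξ j) x)⟩

theorem innerForm_add (x y : EuclideanSpace ℝ (Fin n)) :
    innerForm 𝕜 (x + y) = innerForm 𝕜 x + innerForm 𝕜 y := by
  ext w; simp [innerForm_apply, inner_add_left]

theorem innerForm_smul (c : ℝ) (x : EuclideanSpace ℝ (Fin n)) :
    innerForm 𝕜 (c • x) = (c : 𝕜) • innerForm 𝕜 x := by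
  ext w; simp [innerForm_apply, inner_smul_left]

/-- The field `⟪ξ, x⟫^j θ^{⊗ p}`, placed in the component of order `p`, lies in the span. -/
theorem single_tensorField_ridge_mem (hn : 2 ≤ n) (k j : ℕ) (p : Fin (2 * k + 1))
    (ξ θ : EuclideanSpace ℝ (Fin n)) :
    Pi.single p (tensorField Ω p (prodInner 𝕜 fun _ : Fin j => ξ)
      (tensorPow (innerForm 𝕜 θ) p)) ∈ productSpan 𝕜 Ω (2 * k) := by
  obtain ⟨f, c, r, s, hf, rfl, rfl⟩ := exists_orthonormal_frame hn ξ θ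
  have h1 : planeForm f ![(r : 𝕜), s] = innerForm 𝕜 (r • f 0 + s • f 1) := by
    rw [innerForm_add, innerForm_smul, innerForm_smul]; simp [planeForm]
  have h2 : (j.factorial : 𝕜) • planeSmooth f (divPow ![(c : 𝕜), 0] j 0) =
      prodInner 𝕜 fun _ : Fin j => c • f 0 := by
    refine Subtype.ext (funext fun x => ?_)
    change (j.factorial : 𝕜) • planeEval f (divPow ![(c : 𝕜), 0] j 0) x =
      ∏ _ : Fin j, innerForm 𝕜 (c • f 0) x
    have hj : (j.factorial : 𝕜) ≠ 0 := by exact_mod_cast j.factorial_ne_zero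
    rw [innerForm_smul]
    simp [divPow, linPoly, planeEval]
    field_simp
  have := Submodule.smul_mem _ (j.factorial : 𝕜)
    (single_tensorField_divPow_mem Ω hf k (c : 𝕜) j p ![(r : 𝕜), s])
  rwa [← Pi.single_smul, ← LinearMap.smul_apply, ← map_smul, h1, h2] at this

end RidgeFields

/-! ### Polarization -/

section Polarization

/-- A symmetric multilinear map that vanishes on the diagonal is zero. -/
theorem multilinear_eq_zero_of_diagonal {V G : Type*} [AddCommGroup V] [Module ℝ V]
    [NormedAddCommGroup G] [NormedSpace ℝ G] {k : ℕ} (F : MultilinearMap ℝ (fun _ : Fin k => V) G)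
    (hsymm : ∀ (σ : Equiv.Perm (Fin k)) (w : Fin k → V), F (w ∘ σ) = F w)
    (hdiag : ∀ x, F (fun _ => x) = 0) (w : Fin k → V) : F w = 0 := by
  -- the pull-back to `Fin k → ℝ` is continuous, and its `k`-th derivative is computed in two ways
  let L : (Fin k → ℝ) →ₗ[ℝ] V := Fintype.linearCombination ℝ w
  let F' : ContinuousMultilinearMap ℝ (fun _ : Fin k => Fin k → ℝ) G :=
    { F.compLinearMap fun _ => L with
      cont := by
        have : ∀ a : Fin k → Fin k → ℝ, F (fun i => L (a i)) =
            ∑ r : Fin k → Fin k, (∏ i, a i (r i)) • F fun i => w (r i) := by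
          intro a
          simp only [L, Fintype.linearCombination_apply]
          rw [MultilinearMap.map_sum]
          exact Finset.sum_congr rfl fun r _ => F.map_smul_univ _ _
        change Continuous fun a : Fin k → Fin k → ℝ => F (fun i => L (a i))
        simp only [this]
        fun_prop }
  have hF' : ∀ a, F' a = F (fun i => L (a i)) := fun a => rfl
  have h := F'.iteratedFDeriv_comp_diagonal 0 fun i => Pi.single i 1
  have h0 : (fun x => F' fun _ => x) = fun _ => 0 := funext fun x => hdiag (L x)
  have hL : ∀ i, L (Pi.single i 1) = w i := by
    intro i; simp [L, Fintype.linearCombination_apply_single]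
  have hs : ∀ σ : Equiv.Perm (Fin k), F' (fun i => Pi.single (σ i) 1) = F w := by
    intro σ
    rw [hF']
    simp only [hL]
    exact hsymm σ w
  rw [h0] at h
  simp only [hs, Finset.sum_const, Finset.card_univ, Fintype.card_perm, Fintype.card_fin] at h
  rw [iteratedFDeriv_fun_zero] at h
  have h1 : (k.factorial : ℝ) • F w = 0 := by
    rw [Nat.cast_smul_eq_nsmul]; simpa using h.symm
  exact (smul_eq_zero.1 h1).resolve_left (by exact_mod_cast k.factorial_ne_zero)

variable {𝕜 : Type*} [RCLike 𝕜] {n : ℕ} (Ω : Set (EuclideanSpace ℝ (Fin n)))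

/-- The product `∏ ⟪θ i, w i⟫`, as a multilinear map in `θ`. -/
def prodInnerMultilinear (𝕜 : Type*) [RCLike 𝕜] {n k : ℕ}
    (w : Fin k → EuclideanSpace ℝ (Fin n)) :
    MultilinearMap ℝ (fun _ : Fin k => EuclideanSpace ℝ (Fin n)) 𝕜 :=
  (MultilinearMap.mkPiAlgebra ℝ (Fin k) 𝕜).compLinearMap fun i =>
    (innerForm 𝕜 (w i)).toLinearMap

theorem prodInnerMultilinear_apply {k : ℕ} (w θ : Fin k → EuclideanSpace ℝ (Fin n)) :
    prodInnerMultilinear 𝕜 w θ = ∏ i, innerForm 𝕜 (θ i) (w i) := by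
  simp only [prodInnerMultilinear, MultilinearMap.compLinearMap_apply,
    MultilinearMap.mkPiAlgebra_apply]
  refine Finset.prod_congr rfl fun i _ => ?_
  change innerForm 𝕜 (w i) (θ i) = _
  rw [innerForm_apply, innerForm_apply, real_inner_comm]

/-- The tensor `⟪θ₁, ·⟫ ⊗ ⋯ ⊗ ⟪θ_p, ·⟫`. -/
def prodTensor (𝕜 : Type*) [RCLike 𝕜] {n p : ℕ} (θ : Fin p → EuclideanSpace ℝ (Fin n)) :
    (EuclideanSpace ℝ (Fin n)) [×p]→L[ℝ] 𝕜 :=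
  (ContinuousMultilinearMap.mkPiAlgebra ℝ (Fin p) 𝕜).compContinuousLinearMap
    fun i => innerForm 𝕜 (θ i)

theorem prodTensor_apply {p : ℕ} (θ w : Fin p → EuclideanSpace ℝ (Fin n)) :
    prodTensor 𝕜 θ w = ∏ i, innerForm 𝕜 (θ i) (w i) := by
  simp [prodTensor]

/-- A multilinear map with values in the `𝕜`-vector space `W`, as a multilinear form over `ℝ`. -/
def realMultilinear {W : Type*} [AddCommGroup W] [Module 𝕜 W] {k : ℕ}
    (ψ : W →ₗ[𝕜] 𝕜) (Φ : (Fin k → EuclideanSpace ℝ (Fin n)) → W)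
    (hadd : ∀ (m : Fin k → EuclideanSpace ℝ (Fin n)) (i : Fin k) (x y : EuclideanSpace ℝ (Fin n)),
      Φ (Function.update m i (x + y)) = Φ (Function.update m i x) + Φ (Function.update m i y))
    (hsmul : ∀ (m : Fin k → EuclideanSpace ℝ (Fin n)) (i : Fin k) (c : ℝ)
      (x : EuclideanSpace ℝ (Fin n)),
      Φ (Function.update m i (c • x)) = (c : 𝕜) • Φ (Function.update m i x)) :
    MultilinearMap ℝ (fun _ : Fin k => EuclideanSpace ℝ (Fin n)) 𝕜 where
  toFun m := ψ (Φ m)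
  map_update_add' := by
    intro hdec m i x y
    obtain rfl : hdec = instDecidableEqFin k := Subsingleton.elim _ _
    rw [hadd, map_add]
  map_update_smul' := by
    intro hdec m i c x
    obtain rfl : hdec = instDecidableEqFin k := Subsingleton.elim _ _
    rw [hsmul, map_smul, smul_eq_mul, RCLike.real_smul_eq_coe_mul]

/-- Polarization: a subspace that contains the values of a symmetric multilinear map on the
diagonal contains all its values. -/
theorem mem_of_forall_diagonal_mem {W : Type*} [AddCommGroup W] [Module 𝕜 W] {k : ℕ}
    (S : Submodule 𝕜 W) (Φ : (Fin k → EuclideanSpace ℝ (Fin n)) → W)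
    (hadd : ∀ (m : Fin k → EuclideanSpace ℝ (Fin n)) (i : Fin k) (x y : EuclideanSpace ℝ (Fin n)),
      Φ (Function.update m i (x + y)) = Φ (Function.update m i x) + Φ (Function.update m i y))
    (hsmul : ∀ (m : Fin k → EuclideanSpace ℝ (Fin n)) (i : Fin k) (c : ℝ)
      (x : EuclideanSpace ℝ (Fin n)),
      Φ (Function.update m i (c • x)) = (c : 𝕜) • Φ (Function.update m i x))
    (hsymm : ∀ (σ : Equiv.Perm (Fin k)) (m : Fin k → EuclideanSpace ℝ (Fin n)), Φ (m ∘ σ) = Φ m)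
    (hdiag : ∀ x, Φ (fun _ => x) ∈ S) (m : Fin k → EuclideanSpace ℝ (Fin n)) : Φ m ∈ S := by
  by_contra hmem
  obtain ⟨ψ, hψ, hker⟩ := Submodule.exists_le_ker_of_notMem hmem
  exact hψ (multilinear_eq_zero_of_diagonal (realMultilinear ψ Φ hadd hsmul)
    (fun σ w => congrArg ψ (hsymm σ w)) (fun x => hker (hdiag x)) m)

theorem prodInner_eq {k : ℕ} (ξ : Fin k → EuclideanSpace ℝ (Fin n)) (x : EuclideanSpace ℝ (Fin n)) :
    (prodInner 𝕜 ξ).1 x = prodInnerMultilinear 𝕜 (fun _ => x) ξ :=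
  (prodInnerMultilinear_apply _ _).symm

theorem symmetrize_prodTensor_comp_perm {p : ℕ} (θ : Fin p → EuclideanSpace ℝ (Fin n))
    (σ : Equiv.Perm (Fin p)) :
    symmetrize 𝕜 n p (prodTensor 𝕜 (θ ∘ σ)) = symmetrize 𝕜 n p (prodTensor 𝕜 θ) := by
  ext w
  rw [symmetrize_apply, symmetrize_apply]
  congr 1
  refine Fintype.sum_equiv (Equiv.mulRight σ⁻¹) _ _ fun τ => ?_
  rw [prodTensor_apply, prodTensor_apply]
  exact Fintype.prod_equiv σ _ _ fun i => by simp

/-- A tensor is a linear combination of products of linear forms. -/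
theorem eq_sum_smul_prodTensor {p : ℕ} (T : (EuclideanSpace ℝ (Fin n)) [×p]→L[ℝ] 𝕜) :
    T = ∑ r : Fin p → Fin n, T (fun i => EuclideanSpace.basisFun (Fin n) ℝ (r i)) •
      prodTensor 𝕜 fun i => EuclideanSpace.basisFun (Fin n) ℝ (r i) := by
  ext w
  have hw : w = fun i => ∑ j, inner ℝ (EuclideanSpace.basisFun (Fin n) ℝ j) (w i) •
      EuclideanSpace.basisFun (Fin n) ℝ j :=
    funext fun i => ((EuclideanSpace.basisFun (Fin n) ℝ).sum_repr' (w i)).symm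
  conv_lhs => rw [hw]
  rw [ContinuousMultilinearMap.map_sum, sum_apply]
  refine Finset.sum_congr rfl fun r _ => ?_
  rw [ContinuousMultilinearMap.map_smul_univ, smul_apply, prodTensor_apply,
    RCLike.real_smul_eq_coe_mul, smul_eq_mul, mul_comm]
  simp only [innerForm_apply]
  push_cast
  rfl

/-- Polarization of `single_tensorField_ridge_mem` in `ξ` and in `θ`. -/
theorem single_tensorField_prodInner_mem (hn : 2 ≤ n) (k j : ℕ) (p : Fin (2 * k + 1))
    (ξ : Fin j → EuclideanSpace ℝ (Fin n)) (T : (EuclideanSpace ℝ (Fin n)) [×(p : ℕ)]→L[ℝ] 𝕜) :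
    Pi.single p (tensorField Ω p (prodInner 𝕜 ξ) T) ∈ productSpan 𝕜 Ω (2 * k) := by
  rw [eq_sum_smul_prodTensor T, map_sum, ← LinearMap.single_apply (R := 𝕜), map_sum]
  refine Submodule.sum_mem _ fun r _ => ?_
  rw [map_smul, map_smul]
  refine Submodule.smul_mem _ _ ?_
  rw [LinearMap.single_apply]
  generalize (fun i => EuclideanSpace.basisFun (Fin n) ℝ (r i)) = θ
  -- polarization in `θ`, then in `ξ`
  refine mem_of_forall_diagonal_mem (productSpan 𝕜 Ω (2 * k))
    (fun θ => Pi.single p (tensorField Ω p (prodInner 𝕜 ξ) (prodTensor 𝕜 θ)))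
    (fun m i x y => ?_) (fun m i c x => ?_) (fun σ m => ?_) (fun θ => ?_) θ
  · rw [← Pi.single_add, ← map_add]
    congr 2
    ext w
    simp only [add_apply, prodTensor_apply, ← prodInnerMultilinear_apply,
      MultilinearMap.map_update_add]
  · rw [← Pi.single_smul, ← map_smul]
    congr 2
    ext w
    simp only [smul_apply, prodTensor_apply, ← prodInnerMultilinear_apply,
      MultilinearMap.map_update_smul, smul_eq_mul, RCLike.real_smul_eq_coe_mul]
  · congr 1
    refine SymTensorField.ext fun x => ?_
    rw [tensorField_apply, tensorField_apply, symmetrize_prodTensor_comp_perm]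
  · refine mem_of_forall_diagonal_mem (productSpan 𝕜 Ω (2 * k))
      (fun ξ => Pi.single p (tensorField Ω p (prodInner 𝕜 ξ) (prodTensor 𝕜 fun _ => θ)))
      (fun m i x y => ?_) (fun m i c x => ?_) (fun σ m => ?_) (fun ξ => ?_) ξ
    · rw [← Pi.single_add, ← LinearMap.add_apply, ← map_add]
      congr 3
      refine Subtype.ext (funext fun z => ?_)
      change _ = (prodInner 𝕜 _).1 z + (prodInner 𝕜 _).1 z
      rw [prodInner_eq, prodInner_eq, prodInner_eq, MultilinearMap.map_update_add]
    · rw [← Pi.single_smul, ← LinearMap.smul_apply, ← map_smul]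
      congr 3
      refine Subtype.ext (funext fun z => ?_)
      change _ = (c : 𝕜) • (prodInner 𝕜 _).1 z
      rw [prodInner_eq, prodInner_eq, MultilinearMap.map_update_smul,
        RCLike.real_smul_eq_coe_mul, smul_eq_mul]
    · congr 3
      refine Subtype.ext (funext fun z => ?_)
      exact Fintype.prod_equiv σ _ _ fun i => rfl
    · exact single_tensorField_ridge_mem Ω hn k j p ξ θ

end Polarization

/-! ### Approximation by polynomials with the Landau kernel -/

section Approximation
open MeasureTheory Metric Filter Topology
open scoped Convolution

variable {n : ℕ}

/-- The space of polynomial functions on `ℝⁿ` with values in `G`. -/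
def polyFunctions (n : ℕ) (G : Type*) [NormedAddCommGroup G] [NormedSpace ℝ G] :
    Submodule ℝ (EuclideanSpace ℝ (Fin n) → G) :=
  Submodule.span ℝ {q | ∃ (k : ℕ) (ξ : Fin k → EuclideanSpace ℝ (Fin n)) (T : G),
    q = fun x => (∏ j, inner ℝ (ξ j) x) • T}

variable {G : Type*} [NormedAddCommGroup G] [NormedSpace ℝ G]

theorem inner_smul_mem_polyFunctions (ξ : EuclideanSpace ℝ (Fin n))
    {q : EuclideanSpace ℝ (Fin n) → G} (hq : q ∈ polyFunctions n G) :
    (fun x => inner ℝ ξ x • q x) ∈ polyFunctions n G := by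
  induction hq using Submodule.span_induction with
  | mem q h =>
    obtain ⟨k, η, T, rfl⟩ := h
    refine Submodule.subset_span ⟨k + 1, Fin.cons ξ η, T, ?_⟩
    funext x
    rw [Fin.prod_univ_succ]
    simp [smul_smul]
  | zero =>
    convert (polyFunctions n G).zero_mem using 1
    funext x
    exact smul_zero _
  | add a b _ _ ha hb =>
    convert (polyFunctions n G).add_mem ha hb using 1
    funext x
    exact smul_add _ _ _
  | smul c a _ ha =>
    have := (polyFunctions n G).smul_mem c ha
    convert this using 1
    funext x
    exact smul_comm _ _ _

theorem contDiff_of_mem_polyFunctions {q : EuclideanSpace ℝ (Fin n) → G}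
    (hq : q ∈ polyFunctions n G) : ContDiff ℝ ∞ q := by
  induction hq using Submodule.span_induction with
  | mem q h =>
    obtain ⟨k, η, T, rfl⟩ := h
    exact (contDiff_prod fun j _ => contDiff_const.inner ℝ contDiff_id).smul contDiff_const
  | zero => exact contDiff_const
  | add a b _ _ ha hb => exact ha.add hb
  | smul c a _ ha => exact ha.const_smul c

/-- The kernel `1 - |y|² / ρ²`, whose powers concentrate at the origin of the ball of radius
`ρ`. -/
def landau (ρ : ℝ) (y : EuclideanSpace ℝ (Fin n)) : ℝ := 1 - ‖y‖ ^ 2 / ρ ^ 2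

theorem continuous_landau (ρ : ℝ) : Continuous (landau ρ : EuclideanSpace ℝ (Fin n) → ℝ) := by
  unfold landau; fun_prop

theorem landau_sub (ρ : ℝ) (x z : EuclideanSpace ℝ (Fin n)) :
    landau ρ (x - z) = landau ρ z + ∑ i, inner ℝ (EuclideanSpace.basisFun (Fin n) ℝ i) x *
      (2 / ρ ^ 2 * inner ℝ (EuclideanSpace.basisFun (Fin n) ℝ i) z -
        (ρ ^ 2)⁻¹ * inner ℝ (EuclideanSpace.basisFun (Fin n) ℝ i) x) := by
  have h1 := (EuclideanSpace.basisFun (Fin n) ℝ).sum_inner_mul_inner x x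
  have h2 := (EuclideanSpace.basisFun (Fin n) ℝ).sum_inner_mul_inner x z
  rw [real_inner_self_eq_norm_sq] at h1
  simp only [mul_sub, Finset.sum_sub_distrib]
  have e1 : ∑ i, inner ℝ (EuclideanSpace.basisFun (Fin n) ℝ i) x *
      (2 / ρ ^ 2 * inner ℝ (EuclideanSpace.basisFun (Fin n) ℝ i) z) = 2 / ρ ^ 2 * inner ℝ x z := by
    rw [← h2, Finset.mul_sum]; exact Finset.sum_congr rfl fun i _ => by
      rw [real_inner_comm x]; ring
  have e2 : ∑ i, inner ℝ (EuclideanSpace.basisFun (Fin n) ℝ i) x *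
      ((ρ ^ 2)⁻¹ * inner ℝ (EuclideanSpace.basisFun (Fin n) ℝ i) x) = (ρ ^ 2)⁻¹ * ‖x‖ ^ 2 := by
    rw [← h1, Finset.mul_sum]; exact Finset.sum_congr rfl fun i _ => by
      rw [real_inner_comm x]; ring
  rw [e1, e2, landau, landau, norm_sub_sq_real]
  ring

/-- The convolution of a polynomial with a compactly supported function is a polynomial. -/
theorem integral_landau_pow_mem_polyFunctions (ρ : ℝ) (N : ℕ) :
    ∀ {F : EuclideanSpace ℝ (Fin n) → G}, Continuous F → HasCompactSupport F →
      (fun x => ∫ z, landau ρ (x - z) ^ N • F z) ∈ polyFunctions n G := by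
  induction N with
  | zero =>
    intro F hF hc
    refine Submodule.subset_span ⟨0, Fin.elim0, ∫ z, F z, ?_⟩
    simp
  | succ N ih =>
    intro F hF hc
    set b := EuclideanSpace.basisFun (Fin n) ℝ with hb
    have hint : ∀ (x : EuclideanSpace ℝ (Fin n)) (g : EuclideanSpace ℝ (Fin n) → ℝ),
        Continuous g → Integrable fun z => landau ρ (x - z) ^ N • g z • F z := by
      intro x g hg
      have := continuous_landau (n := n) ρ
      refine Continuous.integrable_of_hasCompactSupport (by fun_prop) ?_
      exact (hc.smul_left (f := g)).smul_left (f := fun z => landau ρ (x - z) ^ N)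
    have hmem : ∀ g : EuclideanSpace ℝ (Fin n) → ℝ, Continuous g →
        (fun x => ∫ z, landau ρ (x - z) ^ N • g z • F z) ∈ polyFunctions n G := fun g hg =>
      ih (hg.smul hF) (hc.smul_left (f := g))
    have hsplit : (fun x => ∫ z, landau ρ (x - z) ^ (N + 1) • F z) =
        (fun x => ∫ z, landau ρ (x - z) ^ N • landau ρ z • F z) +
        ∑ i, ((2 / ρ ^ 2) • (fun x => inner ℝ (b i) x •
            ∫ z, landau ρ (x - z) ^ N • inner ℝ (b i) z • F z) -
          (ρ ^ 2)⁻¹ • fun x => inner ℝ (b i) x • inner ℝ (b i) x •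
            ∫ z, landau ρ (x - z) ^ N • (1 : ℝ) • F z) := by
      funext x
      have hx : ∀ z, landau ρ (x - z) ^ (N + 1) • F z =
          landau ρ (x - z) ^ N • landau ρ z • F z +
          ∑ i, ((2 / ρ ^ 2 * inner ℝ (b i) x) • (landau ρ (x - z) ^ N • inner ℝ (b i) z • F z) -
            ((ρ ^ 2)⁻¹ * inner ℝ (b i) x * inner ℝ (b i) x) •
              (landau ρ (x - z) ^ N • (1 : ℝ) • F z)) := by
        intro z
        simp only [smul_smul, ← sub_smul, ← Finset.sum_smul, ← add_smul]
        congr 1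
        rw [pow_succ]
        nth_rewrite 2 [landau_sub]
        rw [mul_add, Finset.mul_sum]
        congr 1
        exact Finset.sum_congr rfl fun i _ => by ring
      simp only [hx]
      have hi : ∀ i, Integrable fun z => (2 / ρ ^ 2 * inner ℝ (b i) x) •
          (landau ρ (x - z) ^ N • inner ℝ (b i) z • F z) := fun i =>
        (hint x (fun z => inner ℝ (b i) z) (by fun_prop)).smul _
      have hj : ∀ i, Integrable fun z => ((ρ ^ 2)⁻¹ * inner ℝ (b i) x * inner ℝ (b i) x) •
              (landau ρ (x - z) ^ N • (1 : ℝ) • F z) := fun i =>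
        (hint x (fun _ => 1) continuous_const).smul _
      have hij : ∀ i, Integrable fun z => (2 / ρ ^ 2 * inner ℝ (b i) x) •
          (landau ρ (x - z) ^ N • inner ℝ (b i) z • F z) -
            ((ρ ^ 2)⁻¹ * inner ℝ (b i) x * inner ℝ (b i) x) •
              (landau ρ (x - z) ^ N • (1 : ℝ) • F z) := fun i => (hi i).sub (hj i)
      rw [integral_add (hint x _ (continuous_landau ρ)) (integrable_finsetSum _ fun i _ => hij i),
        integral_finsetSum _ fun i _ => hij i]
      simp only [Pi.add_apply, Finset.sum_apply, Pi.sub_apply, Pi.smul_apply]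
      congr 1
      refine Finset.sum_congr rfl fun i _ => ?_
      rw [integral_sub (hi i) (hj i), integral_smul, integral_smul]
      simp only [smul_smul, mul_assoc]
    rw [hsplit]
    refine Submodule.add_mem _ (hmem _ (continuous_landau ρ)) (Submodule.sum_mem _ fun i _ =>
      Submodule.sub_mem _ (Submodule.smul_mem _ _ ?_) (Submodule.smul_mem _ _ ?_))
    · exact inner_smul_mem_polyFunctions _ (hmem _ (by fun_prop))
    · exact inner_smul_mem_polyFunctions _
        (inner_smul_mem_polyFunctions _ (hmem _ continuous_const))

/-- The normalized convolution of `F` with the `N`-th power of the Landau kernel. -/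
def landauApprox (ρ : ℝ) (N : ℕ) (F : EuclideanSpace ℝ (Fin n) → G) :
    EuclideanSpace ℝ (Fin n) → G :=
  (∫ y in closedBall (0 : EuclideanSpace ℝ (Fin n)) ρ, landau ρ y ^ N)⁻¹ •
    ((fun y => landau ρ y ^ N) ⋆[ContinuousLinearMap.lsmul ℝ ℝ, volume] F)

theorem landauApprox_mem_polyFunctions (ρ : ℝ) (N : ℕ) {F : EuclideanSpace ℝ (Fin n) → G}
    (hF : Continuous F) (hc : HasCompactSupport F) :
    landauApprox ρ N F ∈ polyFunctions n G := by
  refine Submodule.smul_mem _ _ ?_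
  convert integral_landau_pow_mem_polyFunctions ρ N hF hc using 1
  funext x
  exact convolution_lsmul_swap

theorem fderiv_landauApprox [CompleteSpace G] (ρ : ℝ) (N : ℕ) {F : EuclideanSpace ℝ (Fin n) → G}
    (hF : ContDiff ℝ ∞ F) (hc : HasCompactSupport F) :
    fderiv ℝ (landauApprox ρ N F) = landauApprox ρ N (fderiv ℝ F) := by
  funext x
  have hl : LocallyIntegrable (fun y : EuclideanSpace ℝ (Fin n) => landau ρ y ^ N) volume :=
    ((continuous_landau ρ).pow N).locallyIntegrable
  have h := (hc.hasFDerivAt_convolution_right (ContinuousLinearMap.lsmul ℝ ℝ) hl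
    (hF.of_le (by exact_mod_cast le_top)) x).const_smul
    ((∫ y in closedBall (0 : EuclideanSpace ℝ (Fin n)) ρ, landau ρ y ^ N)⁻¹)
  exact h.fderiv

/-- The Landau approximations converge uniformly on the ball of radius `r`. With `ρ = 2 r + 1`, the
differences of points of this ball stay in the ball of radius `ρ`, where the kernel is
nonnegative. -/
theorem tendsto_landauApprox {r : ℝ} (hr : 0 ≤ r) {F : EuclideanSpace ℝ (Fin n) → G}
    [CompleteSpace G]
    (hF : Continuous F) (hs : tsupport F ⊆ closedBall 0 r) {ε : ℝ} (hε : 0 < ε) :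
    ∀ᶠ N in atTop, ∀ x ∈ closedBall (0 : EuclideanSpace ℝ (Fin n)) r,
      ‖landauApprox (2 * r + 1) N F x - F x‖ ≤ ε := by
  set ρ := 2 * r + 1 with hρ
  have hρ0 : 0 < ρ := by positivity
  have hc : HasCompactSupport F :=
    (isCompact_closedBall 0 r).of_isClosed_subset (isClosed_tsupport F) hs
  obtain ⟨S, hS⟩ := hc.exists_bound_of_continuous hF
  have hS0 : 0 ≤ S := (norm_nonneg _).trans (hS 0)
  obtain ⟨δ, hδ, hu⟩ := Metric.uniformContinuous_iff.1
    (hc.uniformContinuous_of_continuous hF) (ε / 2) (half_pos hε)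
  -- a continuous majorant of the modulus of continuity
  set m : EuclideanSpace ℝ (Fin n) → ℝ := fun y => ε / 2 + 2 * S / δ ^ 2 * ‖y‖ ^ 2 with hm
  have hmc : Continuous m := by fun_prop
  have hmb : ∀ x y, ‖F (x - y) - F x‖ ≤ m y := by
    intro x y
    by_cases hy : ‖y‖ < δ
    · have := hu (a := x - y) (b := x) (by simpa [dist_eq_norm] using hy)
      rw [dist_eq_norm] at this
      have : 0 ≤ 2 * S / δ ^ 2 * ‖y‖ ^ 2 := by positivity
      simp only [hm]; linarith
    · have h1 : ‖F (x - y) - F x‖ ≤ S + S := (norm_sub_le _ _).trans (add_le_add (hS _) (hS _))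
      have h2 : 2 * S ≤ 2 * S / δ ^ 2 * ‖y‖ ^ 2 := by
        rw [div_mul_eq_mul_div, le_div_iff₀ (by positivity)]
        have : δ ^ 2 ≤ ‖y‖ ^ 2 := by gcongr; exact not_lt.1 hy
        gcongr
      simp only [hm]; linarith
  have hpeak : ∀ g : EuclideanSpace ℝ (Fin n) → ℝ, Continuous g → Tendsto (fun N : ℕ =>
      (∫ y in closedBall (0 : EuclideanSpace ℝ (Fin n)) ρ, landau ρ y ^ N)⁻¹ •
        ∫ y in closedBall (0 : EuclideanSpace ℝ (Fin n)) ρ, landau ρ y ^ N • g y) atTop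
      (𝓝 (g 0)) := by
    intro g hg
    refine tendsto_setIntegral_pow_smul_of_unique_maximum_of_isCompact_of_continuousOn
      (isCompact_closedBall 0 ρ) (continuous_landau ρ).continuousOn ?_ ?_ ?_ ?_ hg.continuousOn
    · intro y _ hy
      have : 0 < ‖y‖ ^ 2 / ρ ^ 2 := by have := norm_pos_iff.2 hy; positivity
      simpa [landau] using this
    · intro y hy
      have : ‖y‖ ≤ ρ := by simpa using hy
      rw [landau, sub_nonneg, div_le_one (by positivity)]
      gcongr
    · simp [landau]
    · exact subset_closure (interior_mono ball_subset_closedBall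
        (by rw [isOpen_ball.interior_eq]; exact mem_ball_self hρ0))
  have hlim := hpeak m hmc
  have hone := hpeak (fun _ => 1) continuous_const
  have hm0 : m 0 = ε / 2 := by simp [hm]
  rw [hm0] at hlim
  filter_upwards [hlim.eventually_lt_const (half_lt_self hε),
    hone.eventually_const_lt (zero_lt_one (α := ℝ))] with N hN hN1 x hx
  set I := ∫ y in closedBall (0 : EuclideanSpace ℝ (Fin n)) ρ, landau ρ y ^ N with hI
  have hI0 : I ≠ 0 := by
    rintro h
    simp [h] at hN1
  have hnn : ∀ y ∈ closedBall (0 : EuclideanSpace ℝ (Fin n)) ρ, 0 ≤ landau ρ y ^ N := by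
    intro y hy
    have : ‖y‖ ≤ ρ := by simpa using hy
    refine pow_nonneg ?_ N
    rw [landau, sub_nonneg, div_le_one (by positivity)]
    gcongr
  have hIpos : 0 ≤ I⁻¹ := inv_nonneg.2 (setIntegral_nonneg isClosed_closedBall.measurableSet hnn)
  have hconv : landauApprox ρ N F x = I⁻¹ • ∫ y in closedBall 0 ρ, landau ρ y ^ N • F (x - y) := by
    change I⁻¹ • (∫ y, landau ρ y ^ N • F (x - y)) = _
    congr 1
    refine (setIntegral_eq_integral_of_forall_compl_eq_zero fun y hy => ?_).symm
    have : F (x - y) = 0 := by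
      refine image_eq_zero_of_notMem_tsupport fun h => hy ?_
      have h1 : ‖x - y‖ ≤ r := by simpa using hs h
      have h2 : ‖x‖ ≤ r := by simpa using hx
      have h3 : ‖y‖ ≤ ‖x‖ + ‖x - y‖ := by
        calc ‖y‖ = ‖x - (x - y)‖ := by simp
          _ ≤ _ := norm_sub_le _ _
      simp [hρ]; linarith
    rw [this, smul_zero]
  have hcontl := continuous_landau (n := n) ρ
  have hcomp := isCompact_closedBall (0 : EuclideanSpace ℝ (Fin n)) ρ
  have hFx : F x = I⁻¹ • ∫ y in closedBall (0 : EuclideanSpace ℝ (Fin n)) ρ,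
      landau ρ y ^ N • F x := by
    rw [integral_smul_const, smul_smul, inv_mul_cancel₀ hI0, one_smul]
  have hdiff : landauApprox ρ N F x - F x = I⁻¹ • ∫ y in closedBall 0 ρ,
      landau ρ y ^ N • (F (x - y) - F x) := by
    rw [hconv]
    conv_lhs => rw [hFx]
    rw [← smul_sub, ← integral_sub]
    · simp only [smul_sub]
    · exact (Continuous.continuousOn (by fun_prop)).integrableOn_compact hcomp
    · exact (Continuous.continuousOn (by fun_prop)).integrableOn_compact hcomp
  rw [hdiff, norm_smul, Real.norm_of_nonneg hIpos]
  refine le_trans (mul_le_mul_of_nonneg_left ?_ hIpos) hN.le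
  refine norm_integral_le_of_norm_le
    ((Continuous.continuousOn (by fun_prop)).integrableOn_compact hcomp) ?_
  refine (ae_restrict_iff' isClosed_closedBall.measurableSet).2 (Eventually.of_forall ?_)
  intro y hy
  rw [norm_smul, Real.norm_of_nonneg (hnn y hy), smul_eq_mul]
  exact mul_le_mul_of_nonneg_left (hmb x y) (hnn y hy)

/-- Convolution commutes with derivatives, so the derivatives of the Landau approximations converge
uniformly as well. -/
theorem eventually_norm_iteratedFDeriv_landauApprox_sub_le {r : ℝ} (hr : 0 ≤ r) (k : ℕ) {ε : ℝ}
    (hε : 0 < ε) : ∀ {G : Type*} [NormedAddCommGroup G] [NormedSpace ℝ G] [CompleteSpace G]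
    {F : EuclideanSpace ℝ (Fin n) → G}, ContDiff ℝ ∞ F → tsupport F ⊆ closedBall 0 r →
    ∀ᶠ N in atTop, ∀ x ∈ closedBall (0 : EuclideanSpace ℝ (Fin n)) r,
      ‖iteratedFDeriv ℝ k (landauApprox (2 * r + 1) N F) x - iteratedFDeriv ℝ k F x‖ ≤ ε := by
  induction k with
  | zero =>
    intro G _ _ _ F hF hs
    filter_upwards [tendsto_landauApprox hr hF.continuous hs hε] with N hN x hx
    rw [iteratedFDeriv_zero_eq_comp, iteratedFDeriv_zero_eq_comp, Function.comp_apply,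
      Function.comp_apply, ← map_sub, LinearIsometryEquiv.norm_map]
    exact hN x hx
  | succ k ih =>
    intro G _ _ _ F hF hs
    have hc : HasCompactSupport F :=
      (isCompact_closedBall 0 r).of_isClosed_subset (isClosed_tsupport F) hs
    filter_upwards [ih (hF.fderiv_right (m := ∞) (by simp))
      ((tsupport_fderiv_subset ℝ).trans hs)] with N hN x hx
    rw [iteratedFDeriv_succ_eq_comp_right, iteratedFDeriv_succ_eq_comp_right, Function.comp_apply,
      Function.comp_apply, ← dist_eq_norm, LinearIsometryEquiv.dist_map, dist_eq_norm]
    change ‖iteratedFDeriv ℝ k (fderiv ℝ (landauApprox (2 * r + 1) N F)) x - _‖ ≤ ε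
    rw [fderiv_landauApprox _ _ hF hc]
    exact hN x hx

end Approximation

/-! ### Density in the space of smooth symmetric tensor fields -/

section Density
open Filter Topology Metric

variable {𝕜 : Type*} [RCLike 𝕜] {n : ℕ} {Ω : Set (EuclideanSpace ℝ (Fin n))}

theorem real_smul_tensor {p : ℕ} (c : ℝ) (T : (EuclideanSpace ℝ (Fin n)) [×p]→L[ℝ] 𝕜) :
    c • T = (c : 𝕜) • T := by
  ext w
  rw [smul_apply, smul_apply, RCLike.real_smul_eq_coe_mul, smul_eq_mul]

/-- Uniform convergence of the derivatives of each order on `closure Ω` is convergence. -/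
theorem tendsto_symTensorField {p : ℕ} {u : ℕ → SymTensorField 𝕜 Ω p} {F : SymTensorField 𝕜 Ω p}
    (h : ∀ k, TendstoUniformly (fun N => (u N).iteratedDerivOnClosure k)
      (F.iteratedDerivOnClosure k) atTop) : Tendsto u atTop (𝓝 F) := by
  rw [nhds_iInf, tendsto_iInf]
  intro k
  rw [nhds_induced, tendsto_comap_iff, UniformFun.tendsto_iff_tendstoUniformly]
  exact h k

/-- The symmetrization of a polynomial tensor field lies in the span of the products. -/
theorem exists_single_mem_productSpan (hn : 2 ≤ n) (k : ℕ) (p : Fin (2 * k + 1))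
    {q : EuclideanSpace ℝ (Fin n) → (EuclideanSpace ℝ (Fin n)) [×(p : ℕ)]→L[ℝ] 𝕜}
    (hq : q ∈ polyFunctions n ((EuclideanSpace ℝ (Fin n)) [×(p : ℕ)]→L[ℝ] 𝕜)) :
    ∃ F : SymTensorField 𝕜 Ω p, (∀ x : closure Ω, F.1 x = symmetrize 𝕜 n p (q x)) ∧
      Pi.single p F ∈ productSpan 𝕜 Ω (2 * k) := by
  induction hq using Submodule.span_induction with
  | mem q h =>
    obtain ⟨j, ξ, T, rfl⟩ := h
    refine ⟨tensorField Ω p (prodInner 𝕜 ξ) T, fun x => ?_,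
      single_tensorField_prodInner_mem Ω hn k j p ξ T⟩
    rw [tensorField_apply, map_smul, real_smul_tensor]
    congr 1
    change ∏ i, innerForm 𝕜 (ξ i) x = _
    simp only [innerForm_apply]
    push_cast
    rfl
  | zero => exact ⟨0, fun x => (map_zero (symmetrize 𝕜 n p)).symm, by simp⟩
  | add a b _ _ ha hb =>
    obtain ⟨A, hA, hA'⟩ := ha
    obtain ⟨B, hB, hB'⟩ := hb
    refine ⟨A + B, fun x => ?_, by rw [Pi.single_add]; exact Submodule.add_mem _ hA' hB'⟩
    change A.1 x + B.1 x = symmetrize 𝕜 n p (a x + b x)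
    rw [hA, hB, map_add]
  | smul c a _ ha =>
    obtain ⟨A, hA, hA'⟩ := ha
    refine ⟨(c : 𝕜) • A, fun x => ?_, by rw [Pi.single_smul]; exact Submodule.smul_mem _ _ hA'⟩
    change (c : 𝕜) • A.1 x = symmetrize 𝕜 n p (c • a x)
    rw [hA, map_smul, real_smul_tensor]

/-- A symmetric tensor field is a limit of polynomial fields which, placed in the component of order
`p`, lie in the span of the products. -/
theorem exists_tendsto_single_mem_productSpan (hn : 2 ≤ n) (hΩ : IsOpen Ω)
    (hb : Bornology.IsBounded Ω) (k : ℕ) (p : Fin (2 * k + 1)) (F : SymTensorField 𝕜 Ω p) :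
    ∃ u : ℕ → SymTensorField 𝕜 Ω p, Tendsto u atTop (𝓝 F) ∧
      ∀ N, Pi.single p (u N) ∈ productSpan 𝕜 Ω (2 * k) := by
  obtain ⟨R, hR⟩ := hb.closure.subset_closedBall 0
  -- cut off an extension of the field outside a neighbourhood of `closure Ω`
  let χ : ContDiffBump (0 : EuclideanSpace ℝ (Fin n)) :=
    ⟨|R| + 1, |R| + 2, by positivity, by linarith⟩
  have hr : 0 ≤ |R| + 2 := by positivity
  have hsub : closure Ω ⊆ closedBall (0 : EuclideanSpace ℝ (Fin n)) (|R| + 1) :=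
    hR.trans (closedBall_subset_closedBall (by linarith [le_abs_self R]))
  have hsub' : closure Ω ⊆ closedBall (0 : EuclideanSpace ℝ (Fin n)) (|R| + 2) :=
    hsub.trans (closedBall_subset_closedBall (by linarith))
  set h : EuclideanSpace ℝ (Fin n) → (EuclideanSpace ℝ (Fin n)) [×(p : ℕ)]→L[ℝ] 𝕜 :=
    fun x => χ x • F.extension x with hh
  have hsm : ContDiff ℝ ∞ h := χ.contDiff.smul F.contDiff_extension
  have hsupp : tsupport h ⊆ closedBall 0 (|R| + 2) :=
    (tsupport_smul_subset_left χ F.extension).trans χ.tsupport_eq.subset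
  have hc : HasCompactSupport h :=
    (isCompact_closedBall _ _).of_isClosed_subset (isClosed_tsupport h) hsupp
  have hF : ∀ x : closure Ω, F.1 x = symmetrize 𝕜 n p (h x) := by
    intro x
    rw [hh]
    change F.1 x = symmetrize 𝕜 n p (χ x • F.extension x)
    rw [χ.one_of_mem_closedBall (hsub x.2), one_smul, F.extension_apply,
      symmetrize_eq_self (F.2.2 x)]
  have hq := fun N => landauApprox_mem_polyFunctions (2 * (|R| + 2) + 1) N hsm.continuous hc
  choose u hu hmem using fun N => exists_single_mem_productSpan (Ω := Ω) hn k p (hq N)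
  refine ⟨u, tendsto_symTensorField fun j => ?_, hmem⟩
  refine (Metric.tendstoUniformly_iff (F := fun N => (u N).iteratedDerivOnClosure j)
    (f := F.iteratedDerivOnClosure j)).2 ?_
  intro ε hε
  set S := symmetrize 𝕜 n p
  obtain ⟨δ, hδ, hδε⟩ : ∃ δ > 0, ‖S‖ * δ < ε :=
    ⟨ε / (‖S‖ + 1), by positivity, by
      rw [mul_div_assoc', div_lt_iff₀ (by positivity)]; nlinarith [norm_nonneg S]⟩
  filter_upwards [eventually_norm_iteratedFDeriv_landauApprox_sub_le hr j hδ hsm hsupp]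
    with N hN x
  have hqs := contDiff_of_mem_polyFunctions (hq N)
  have e1 := SymTensorField.iteratedDerivOnClosure_eq hΩ j F (S.contDiff.comp hsm) hF x
  have e2 := SymTensorField.iteratedDerivOnClosure_eq hΩ j (u N) (S.contDiff.comp hqs) (hu N) x
  have hSA (A : ContinuousMultilinearMap ℝ (fun _ : Fin j => EuclideanSpace ℝ (Fin n))
      ((EuclideanSpace ℝ (Fin n)) [×(p : ℕ)]→L[ℝ] 𝕜))
      (B : ContinuousMultilinearMap ℝ (fun _ : Fin j => EuclideanSpace ℝ (Fin n))
      ((EuclideanSpace ℝ (Fin n)) [×(p : ℕ)]→L[ℝ] 𝕜)) :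
      dist (S.compContinuousMultilinearMap A) (S.compContinuousMultilinearMap B) ≤
        ‖S‖ * ‖B - A‖ := by
    rw [dist_comm]
    refine le_trans (le_of_eq ?_) (S.norm_compContinuousMultilinearMap_le (B - A))
    have : S.compContinuousMultilinearMap (B - A) =
        S.compContinuousMultilinearMap B - S.compContinuousMultilinearMap A := by
      ext v w
      simp
    rw [this]
    exact dist_eq_norm (S.compContinuousMultilinearMap B) (S.compContinuousMultilinearMap A)
  rw [e1, e2, S.iteratedFDeriv_comp_left hsm.contDiffAt (by exact_mod_cast le_top),
    S.iteratedFDeriv_comp_left hqs.contDiffAt (by exact_mod_cast le_top)]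
  exact ((hSA _ _).trans (mul_le_mul_of_nonneg_left (hN x (hsub' x.2)) (norm_nonneg S))).trans_lt
    hδε

end Density

end PolyharmonicDensity

end

theorem corollary2p2 {𝕜 : Type*} [RCLike 𝕜] (n : ℕ) (hn : 3 ≤ n)
    (Ω : Set (EuclideanSpace ℝ (Fin n))) (hΩ : PolyharmonicDensity.IsSmoothBoundedDomain Ω)
    (M : ℕ) (hM : Even M) :
    Dense (PolyharmonicDensity.productSpan 𝕜 Ω M :
      Set (PolyharmonicDensity.SymTensorFields 𝕜 Ω M)) := by
  obtain ⟨k, rfl⟩ := hM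
  rw [← two_mul]
  intro F
  choose u hu hmem using fun p => PolyharmonicDensity.exists_tendsto_single_mem_productSpan
    (by omega : 2 ≤ n) hΩ.isOpen hΩ.isBounded k p (F p)
  refine mem_closure_of_tendsto (f := fun N p => u p N) (b := Filter.atTop)
    (tendsto_pi_nhds.2 hu) (Filter.Eventually.of_forall fun N => ?_)
  rw [← Finset.univ_sum_single fun p => u p N]
  exact Submodule.sum_mem _ fun p _ => hmem p N
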